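/- Let $n\ge 1$ and let $M$ be a non-empty closed (compact, without boundary) smooth manifold of dimension $2n+1$. Let $\lambda$ be a contact form on $M$, that is, a smooth one-form such that $\lambda\wedge(d\lambda)^n$ vanishes nowhere on $M$ (so it is positive for a suitable orientation of $M$), and let $R$ be its Reeb field, the vector field determined by $\lambda(R)=1$ and $\iota_R d\lambda=0$. For $k\ge 0$ let $C^k$ be the space of smooth $k$-forms $\alpha$ on $M$ with $\iota_Y\alpha=0$ and $\iota_Y d\alpha=0$ for every vector $Y$ tangent to the one-dimensional foliation generated by $R$, and let $H^k_b(M,R)=\ker(d\colon C^k\to C^{k+1})/\operatorname{im}(d\colon C^{k-1}\to C^k)$ be the basic cohomology of this foliation (with $C^{-1}=0$). Then $d\lambda\in C^2$ is closed, and its basic cohomology class $[d\lambda]\in H^2_b(M,R)$ is nonzero. -/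

import Mathlib

open scoped Manifold ContDiff Topology

noncomputable section

namespace BasicCoh

/-! ### Multilinear algebra on one vector space -/

/-- The wedge product of alternating forms: the sum over `(p, q)`-shuffles `σ` of
`sign σ * a (v (σ 1), …, v (σ p)) * b (v (σ (p + 1)), …, v (σ (p + q)))`. -/
def wedge {V : Type*} [AddCommGroup V] [Module ℝ V] {p q : ℕ}
    (a : V [⋀^Fin p]→ₗ[ℝ] ℝ) (b : V [⋀^Fin q]→ₗ[ℝ] ℝ) : V [⋀^Fin (p + q)]→ₗ[ℝ] ℝ :=
  ((LinearMap.mul' ℝ ℝ).compAlternatingMap (a.domCoprod b)).domDomCongr finSumFinEquiv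

/-- The `n`-fold wedge power of an alternating form of degree `k`. -/
def wedgePow {V : Type*} [AddCommGroup V] [Module ℝ V] {k : ℕ}
    (b : V [⋀^Fin k]→ₗ[ℝ] ℝ) : (n : ℕ) → V [⋀^Fin (k * n)]→ₗ[ℝ] ℝ
  | 0 => AlternatingMap.constOfIsEmpty ℝ V (Fin 0) 1
  | n + 1 => wedge (wedgePow b n) b

/-- The contraction `ι_Y a = a (Y, ⋯)` of an alternating form; it is zero in degree zero. -/
def contract {V : Type*} [AddCommGroup V] [Module ℝ V] (Y : V) :
    {k : ℕ} → (V [⋀^Fin k]→ₗ[ℝ] ℝ) → V [⋀^Fin (k - 1)]→ₗ[ℝ] ℝ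
  | 0, _ => 0
  | _ + 1, a => a.curryLeft Y

theorem contract_add {V : Type*} [AddCommGroup V] [Module ℝ V] (Y : V) {k : ℕ}
    (a b : V [⋀^Fin k]→ₗ[ℝ] ℝ) : contract Y (a + b) = contract Y a + contract Y b := by
  cases k <;> simp [contract]

theorem contract_smul {V : Type*} [AddCommGroup V] [Module ℝ V] (Y : V) {k : ℕ}
    (c : ℝ) (a : V [⋀^Fin k]→ₗ[ℝ] ℝ) : contract Y (c • a) = c • contract Y a := by
  cases k <;> simp [contract]

theorem contract_zero {V : Type*} [AddCommGroup V] [Module ℝ V] (Y : V) {k : ℕ} :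
    contract Y (0 : V [⋀^Fin k]→ₗ[ℝ] ℝ) = 0 := by
  simpa using contract_smul Y (0 : ℝ) (0 : V [⋀^Fin k]→ₗ[ℝ] ℝ)

theorem contract_smul_left {V : Type*} [AddCommGroup V] [Module ℝ V] (c : ℝ) (Y : V) {k : ℕ}
    (a : V [⋀^Fin k]→ₗ[ℝ] ℝ) : contract (c • Y) a = c • contract Y a := by
  cases k <;> simp [contract]

/-! ### Differential forms on a manifold without boundary modelled on `E` -/

section Forms

variable {E : Type*} [NormedAddCommGroup E] [NormedSpace ℝ E]
  {M : Type*} [TopologicalSpace M] [ChartedSpace E M]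

/-- Fields of alternating `k`-forms on the tangent spaces of `M`, no regularity required. -/
abbrev FormField (E : Type*) [NormedAddCommGroup E] [NormedSpace ℝ E]
    (M : Type*) [TopologicalSpace M] [ChartedSpace E M] (k : ℕ) : Type _ :=
  ∀ x : M, (TangentSpace 𝓘(ℝ, E) x) [⋀^Fin k]→L[ℝ] ℝ

/-- The coordinate expression of `w` in the chart at `x₀`: the pullback of `w` under the inverse
of that chart. It is meaningful on the target of the chart. -/
def coordRep {k : ℕ} (w : FormField E M k) (x₀ : M) : E → E [⋀^Fin k]→L[ℝ] ℝ := fun y =>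
  (w ((chartAt E x₀).symm y)).compContinuousLinearMap
    (mfderiv 𝓘(ℝ, E) 𝓘(ℝ, E) (chartAt E x₀).symm y)

/-- The exterior derivative: at `x`, take the exterior derivative of the coordinate expression in
the chart at `x` and pull it back to the tangent space at `x` along that chart.
By `coordRep_extDer` any other chart of the atlas gives the same form. -/
def extDer {k : ℕ} (w : FormField E M k) : FormField E M (k + 1) := fun x =>
  (extDeriv (coordRep w x) (chartAt E x x)).compContinuousLinearMap
    (mfderiv 𝓘(ℝ, E) 𝓘(ℝ, E) (chartAt E x) x)

/-- `w` is smooth: its coefficients in the charts of `M` are smooth. -/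
def IsSmoothForm {k : ℕ} (w : FormField E M k) : Prop :=
  ∀ x₀ : M, ContDiffOn ℝ ∞ (coordRep w x₀) (chartAt E x₀).target

theorem coordRep_add {k : ℕ} (w η : FormField E M k) (x₀ : M) :
    coordRep (w + η) x₀ = coordRep w x₀ + coordRep η x₀ := rfl

theorem coordRep_smul {k : ℕ} (c : ℝ) (w : FormField E M k) (x₀ : M) :
    coordRep (c • w) x₀ = c • coordRep w x₀ := rfl

theorem IsSmoothForm.differentiableAt {k : ℕ} {w : FormField E M k} (h : IsSmoothForm w)
    {x₀ : M} {y : E} (hy : y ∈ (chartAt E x₀).target) : DifferentiableAt ℝ (coordRep w x₀) y :=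
  ((h x₀).contDiffAt ((chartAt E x₀).open_target.mem_nhds hy)).differentiableAt (by simp)

theorem extDer_add {k : ℕ} {w η : FormField E M k} (hw : IsSmoothForm w) (hη : IsSmoothForm η) :
    extDer (w + η) = extDer w + extDer η := by
  funext x
  have hx : chartAt E x x ∈ (chartAt E x).target := mem_chart_target E x
  simp only [extDer, Pi.add_apply]
  rw [coordRep_add, extDeriv_add (hw.differentiableAt hx) (hη.differentiableAt hx)]
  rfl

theorem extDer_smul {k : ℕ} (c : ℝ) (w : FormField E M k) :
    extDer (c • w) = c • extDer w := by
  funext x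
  simp only [extDer, Pi.smul_apply]
  rw [coordRep_smul, extDeriv_smul]
  rfl

theorem two_le_smooth : minSmoothness ℝ 2 ≤ (∞ : WithTop ℕ∞) := by
  simp only [minSmoothness_of_isRCLikeNormedField]
  exact WithTop.coe_le_coe.mpr le_top

theorem mdifferentiableAt_chart_aux [IsManifold 𝓘(ℝ, E) ∞ M] (x₀ : M) {p : M}
    (hp : p ∈ (chartAt E x₀).source) :
    MDifferentiableAt 𝓘(ℝ, E) 𝓘(ℝ, E) (chartAt E x₀) p :=
  ((contMDiffOn_chart (I := 𝓘(ℝ, E)) (n := ∞) (x := x₀)).contMDiffAt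
    ((chartAt E x₀).open_source.mem_nhds hp)).mdifferentiableAt (by simp)

theorem mdifferentiableAt_chart_symm_aux [IsManifold 𝓘(ℝ, E) ∞ M] (x₀ : M) {y : E}
    (hy : y ∈ (chartAt E x₀).target) :
    MDifferentiableAt 𝓘(ℝ, E) 𝓘(ℝ, E) (chartAt E x₀).symm y :=
  ((contMDiffOn_chart_symm (I := 𝓘(ℝ, E)) (n := ∞) (x := x₀)).contMDiffAt
    ((chartAt E x₀).open_target.mem_nhds hy)).mdifferentiableAt (by simp)

theorem contDiffAt_transition [IsManifold 𝓘(ℝ, E) ∞ M] (x₀ x₁ : M) {y : E}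
    (hy : y ∈ (chartAt E x₀).target) (hy' : (chartAt E x₀).symm y ∈ (chartAt E x₁).source) :
    ContDiffAt ℝ ∞ (chartAt E x₁ ∘ (chartAt E x₀).symm) y := by
  rw [← contMDiffAt_iff_contDiffAt]
  exact ((contMDiffOn_chart (I := 𝓘(ℝ, E)) (n := ∞) (x := x₁)).contMDiffAt
    ((chartAt E x₁).open_source.mem_nhds hy')).comp y
    ((contMDiffOn_chart_symm (I := 𝓘(ℝ, E)) (n := ∞) (x := x₀)).contMDiffAt
    ((chartAt E x₀).open_target.mem_nhds hy))

/-- The coordinate expressions in two charts are related by pullback along the transition map. -/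
theorem coordRep_eq_pullback [IsManifold 𝓘(ℝ, E) ∞ M] {k : ℕ} (w : FormField E M k) (x₀ x₁ : M)
    {y : E} (hy : y ∈ (chartAt E x₀).target)
    (hy' : (chartAt E x₀).symm y ∈ (chartAt E x₁).source) :
    coordRep w x₀ y =
      (coordRep w x₁ ((chartAt E x₁ ∘ (chartAt E x₀).symm) y)).compContinuousLinearMap
        (fderiv ℝ (chartAt E x₁ ∘ (chartAt E x₀).symm) y) := by
  have hmem : (chartAt E x₁ ∘ (chartAt E x₀).symm) y ∈ (chartAt E x₁).target :=
    (chartAt E x₁).map_source hy'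
  have hq : (chartAt E x₁).symm ((chartAt E x₁ ∘ (chartAt E x₀).symm) y) =
      (chartAt E x₀).symm y := (chartAt E x₁).left_inv hy'
  have hev : (chartAt E x₀).symm =ᶠ[𝓝 y]
      (chartAt E x₁).symm ∘ (chartAt E x₁ ∘ (chartAt E x₀).symm) := by
    have h1 : ∀ᶠ z in 𝓝 y, (chartAt E x₀).symm z ∈ (chartAt E x₁).source :=
      ((chartAt E x₀).continuousAt_symm hy).eventually ((chartAt E x₁).open_source.mem_nhds hy')
    filter_upwards [h1] with z hz
    exact ((chartAt E x₁).left_inv hz).symm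
  have hD := hev.mfderiv_eq (I := 𝓘(ℝ, E)) (I' := 𝓘(ℝ, E))
  rw [mfderiv_comp y (mdifferentiableAt_chart_symm_aux x₁ hmem)
    ((contDiffAt_transition x₀ x₁ hy hy').differentiableAt (by simp)).mdifferentiableAt,
    mfderiv_eq_fderiv] at hD
  let w' : M → E [⋀^Fin k]→L[ℝ] ℝ := w
  let A : E →L[ℝ] E := mfderiv 𝓘(ℝ, E) 𝓘(ℝ, E) (chartAt E x₀).symm y
  let B : E →L[ℝ] E := mfderiv 𝓘(ℝ, E) 𝓘(ℝ, E) (chartAt E x₁).symm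
    ((chartAt E x₁ ∘ (chartAt E x₀).symm) y)
  have hAB : A = B ∘L fderiv ℝ (chartAt E x₁ ∘ (chartAt E x₀).symm) y := hD
  change (w' ((chartAt E x₀).symm y)).compContinuousLinearMap A =
    ((w' ((chartAt E x₁).symm ((chartAt E x₁ ∘ (chartAt E x₀).symm) y))).compContinuousLinearMap
      B).compContinuousLinearMap _
  rw [hq, hAB]
  rfl

/-- The exterior derivative is computed by the coordinate formula in every chart. -/
theorem coordRep_extDer [IsManifold 𝓘(ℝ, E) ∞ M] {k : ℕ} {w : FormField E M k}
    (hw : IsSmoothForm w) (x₀ : M) {y : E} (hy : y ∈ (chartAt E x₀).target) :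
    coordRep (extDer w) x₀ y = extDeriv (coordRep w x₀) y := by
  obtain ⟨x, hx⟩ : ∃ x, x = (chartAt E x₀).symm y := ⟨_, rfl⟩
  have hy' : (chartAt E x₀).symm y ∈ (chartAt E x).source := hx ▸ mem_chart_source E x
  have hmem : (chartAt E x ∘ (chartAt E x₀).symm) y ∈ (chartAt E x).target :=
    (chartAt E x).map_source hy'
  have hev : coordRep w x₀ =ᶠ[𝓝 y] fun z =>
      (coordRep w x ((chartAt E x ∘ (chartAt E x₀).symm) z)).compContinuousLinearMap
        (fderiv ℝ (chartAt E x ∘ (chartAt E x₀).symm) z) := by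
    have h1 : ∀ᶠ z in 𝓝 y, (chartAt E x₀).symm z ∈ (chartAt E x).source :=
      ((chartAt E x₀).continuousAt_symm hy).eventually ((chartAt E x).open_source.mem_nhds hy')
    filter_upwards [h1, (chartAt E x₀).open_target.mem_nhds hy] with z hz hz'
    exact coordRep_eq_pullback w x₀ x hz' hz
  rw [hev.extDeriv_eq, extDeriv_pullback (hw.differentiableAt hmem)
    (contDiffAt_transition x₀ x hy hy') two_le_smooth]
  have hD : mfderiv 𝓘(ℝ, E) 𝓘(ℝ, E) (chartAt E x ∘ (chartAt E x₀).symm) y =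
      (mfderiv 𝓘(ℝ, E) 𝓘(ℝ, E) (chartAt E x) ((chartAt E x₀).symm y)).comp
        (mfderiv 𝓘(ℝ, E) 𝓘(ℝ, E) (chartAt E x₀).symm y) :=
    mfderiv_comp y (mdifferentiableAt_chart_aux x hy') (mdifferentiableAt_chart_symm_aux x₀ hy)
  rw [mfderiv_eq_fderiv] at hD
  rw [hD]
  subst hx
  rfl

theorem IsSmoothForm.extDer [IsManifold 𝓘(ℝ, E) ∞ M] {k : ℕ} {w : FormField E M k}
    (hw : IsSmoothForm w) : IsSmoothForm (extDer w) := by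
  intro x₀
  refine ContDiffOn.congr ?_ fun y hy => coordRep_extDer hw x₀ hy
  have h1 : ContDiffOn ℝ ∞ (fderiv ℝ (coordRep w x₀)) (chartAt E x₀).target :=
    (hw x₀).fderiv_of_isOpen (chartAt E x₀).open_target (by simp)
  exact (ContinuousAlternatingMap.alternatizeUncurryFinCLM ℝ E ℝ (n := k)).contDiff.comp_contDiffOn
    h1

theorem extDer_extDer [IsManifold 𝓘(ℝ, E) ∞ M] {k : ℕ} {w : FormField E M k}
    (hw : IsSmoothForm w) : BasicCoh.extDer (BasicCoh.extDer w) = 0 := by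
  funext x
  have hx : chartAt E x x ∈ (chartAt E x).target := mem_chart_target E x
  have hnhds := (chartAt E x).open_target.mem_nhds hx
  have h1 : coordRep (BasicCoh.extDer w) x =ᶠ[𝓝 (chartAt E x x)] extDeriv (coordRep w x) := by
    filter_upwards [hnhds] with y hy using coordRep_extDer hw x hy
  have h2 : extDeriv (extDeriv (coordRep w x)) (chartAt E x x) = 0 :=
    extDeriv_extDeriv_apply ((hw x).contDiffAt hnhds) two_le_smooth
  rw [BasicCoh.extDer, h1.extDeriv_eq, h2]
  rfl

end Forms

/-! ### The basic complex of a foliation -/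

section Basic

variable {E : Type*} [NormedAddCommGroup E] [NormedSpace ℝ E]
  {M : Type*} [TopologicalSpace M] [ChartedSpace E M]

/-- The contraction `ι_Y (w x)` of a form at the point `x` with a tangent vector `Y` at `x`. -/
def contractAt {k : ℕ} (w : FormField E M k) (x : M) (Y : TangentSpace 𝓘(ℝ, E) x) :
    (TangentSpace 𝓘(ℝ, E) x) [⋀^Fin (k - 1)]→ₗ[ℝ] ℝ :=
  contract Y (w x).toAlternatingMap

/-- The smooth `k`-forms `w` on `M` with `ι_Y w = 0` and `ι_Y dw = 0` for every vector `Y` tangent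
to the foliation whose tangent spaces are `F x`. -/
def basicForms (F : ∀ x : M, Submodule ℝ (TangentSpace 𝓘(ℝ, E) x)) (k : ℕ) :
    Submodule ℝ (FormField E M k) where
  carrier := {w | IsSmoothForm w ∧
    ∀ x, ∀ Y ∈ F x, contractAt w x Y = 0 ∧ contractAt (extDer w) x Y = 0}
  zero_mem' := by
    refine ⟨fun x₀ => (contDiff_const (c := (0 : E [⋀^Fin k]→L[ℝ] ℝ))).contDiffOn, ?_⟩
    intro x Y _
    have h : extDer (0 : FormField E M k) = 0 := by
      simpa using extDer_smul (0 : ℝ) (0 : FormField E M k)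
    rw [h]
    exact ⟨contract_zero Y, contract_zero Y⟩
  add_mem' := by
    rintro w η ⟨hw, hw'⟩ ⟨hη, hη'⟩
    refine ⟨fun x₀ => (hw x₀).add (hη x₀), fun x Y hY => ⟨?_, ?_⟩⟩
    · have := contract_add Y (w x).toAlternatingMap (η x).toAlternatingMap
      exact this.trans (by
        have h1 := (hw' x Y hY).1
        have h2 := (hη' x Y hY).1
        simp only [contractAt] at h1 h2
        rw [h1, h2, add_zero])
    · rw [extDer_add hw hη]
      have := contract_add Y (extDer w x).toAlternatingMap (extDer η x).toAlternatingMap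
      exact this.trans (by
        have h1 := (hw' x Y hY).2
        have h2 := (hη' x Y hY).2
        simp only [contractAt] at h1 h2
        rw [h1, h2, add_zero])
  smul_mem' := by
    rintro c w ⟨hw, hw'⟩
    refine ⟨fun x₀ => (hw x₀).const_smul c, fun x Y hY => ⟨?_, ?_⟩⟩
    · exact (contract_smul Y c (w x).toAlternatingMap).trans (by
        have h1 := (hw' x Y hY).1
        simp only [contractAt] at h1
        rw [h1, smul_zero])
    · rw [extDer_smul]
      exact (contract_smul Y c (extDer w x).toAlternatingMap).trans (by
        have h1 := (hw' x Y hY).2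
        simp only [contractAt] at h1
        rw [h1, smul_zero])

/-- The type of basic `k`-forms: the `k`-th term of the basic complex. -/
def BasicForm (F : ∀ x : M, Submodule ℝ (TangentSpace 𝓘(ℝ, E) x)) (k : ℕ) : Type _ :=
  basicForms F k

instance instAddCommGroupBasicForm (F : ∀ x : M, Submodule ℝ (TangentSpace 𝓘(ℝ, E) x)) (k : ℕ) :
    AddCommGroup (BasicForm F k) :=
  inferInstanceAs (AddCommGroup (basicForms F k))

instance instModuleBasicForm (F : ∀ x : M, Submodule ℝ (TangentSpace 𝓘(ℝ, E) x)) (k : ℕ) :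
    Module ℝ (BasicForm F k) :=
  inferInstanceAs (Module ℝ (basicForms F k))

variable [IsManifold 𝓘(ℝ, E) ∞ M]

/-- The differential of the basic complex: the exterior derivative restricted to basic forms. -/
def basicD (F : ∀ x : M, Submodule ℝ (TangentSpace 𝓘(ℝ, E) x)) (k : ℕ) :
    BasicForm F k →ₗ[ℝ] BasicForm F (k + 1) where
  toFun w := ⟨extDer w.1, w.2.1.extDer, fun x Y hY => ⟨(w.2.2 x Y hY).2, by
    rw [extDer_extDer w.2.1]
    exact contract_zero Y⟩⟩
  map_add' w η := Subtype.ext (extDer_add w.2.1 η.2.1)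
  map_smul' c w := Subtype.ext (extDer_smul c w.1)

theorem basicD_comp_basicD (F : ∀ x : M, Submodule ℝ (TangentSpace 𝓘(ℝ, E) x)) (k : ℕ) :
    basicD F (k + 1) ∘ₗ basicD F k = 0 :=
  LinearMap.ext fun w => Subtype.ext (extDer_extDer w.2.1)

/-- The basic cocycles of degree `k`. -/
abbrev basicCocycles (F : ∀ x : M, Submodule ℝ (TangentSpace 𝓘(ℝ, E) x)) (k : ℕ) :
    Submodule ℝ (BasicForm F k) :=
  LinearMap.ker (basicD F k)

/-- The basic coboundaries of degree `k`: exterior derivatives of *basic* `(k - 1)`-forms. -/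
def basicCoboundaries (F : ∀ x : M, Submodule ℝ (TangentSpace 𝓘(ℝ, E) x)) :
    (k : ℕ) → Submodule ℝ (BasicForm F k)
  | 0 => ⊥
  | k + 1 => LinearMap.range (basicD F k)

/-- The basic cohomology `H^k_b(M, F) = ker d^k / im d^(k-1)`. -/
abbrev BasicCohomology (F : ∀ x : M, Submodule ℝ (TangentSpace 𝓘(ℝ, E) x)) (k : ℕ) : Type _ :=
  basicCocycles F k ⧸ (basicCoboundaries F k).submoduleOf (basicCocycles F k)

/-- The class in basic cohomology of a basic cocycle. -/
def basicClass (F : ∀ x : M, Submodule ℝ (TangentSpace 𝓘(ℝ, E) x)) (k : ℕ)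
    (w : basicCocycles F k) : BasicCohomology F k :=
  Submodule.Quotient.mk w

end Basic

/-! ### Contact forms and Reeb fields -/

section Contact

variable {E : Type*} [NormedAddCommGroup E] [NormedSpace ℝ E]
  {M : Type*} [TopologicalSpace M] [ChartedSpace E M]

/-- `lam` is a contact form on the `(2 n + 1)`-dimensional manifold `M`: a smooth one-form such that
`lam ∧ (d lam)^n` vanishes nowhere, i.e. is a positive volume form for some orientation of `M`. -/
def IsContactForm (n : ℕ) (lam : FormField E M 1) : Prop :=
  IsSmoothForm lam ∧
    ∀ x, wedge (lam x).toAlternatingMap (wedgePow (extDer lam x).toAlternatingMap n) ≠ 0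

/-- `R` is the Reeb field of `lam`: `lam (R) = 1` and `ι_R d lam = 0`. For a contact form, these
equations have exactly one solution `R`, which is smooth. -/
def IsReebField (lam : FormField E M 1) (R : ∀ x : M, TangentSpace 𝓘(ℝ, E) x) : Prop :=
  ∀ x, lam x (fun _ => R x) = 1 ∧ contractAt (extDer lam) x (R x) = 0

/-- The one-dimensional foliation generated by a nowhere zero vector field, through its tangent
lines. -/
def lineFoliation (R : ∀ x : M, TangentSpace 𝓘(ℝ, E) x) (x : M) :
    Submodule ℝ (TangentSpace 𝓘(ℝ, E) x) :=
  Submodule.span ℝ {R x}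

variable [IsManifold 𝓘(ℝ, E) ∞ M]

/-- The exterior derivative of a smooth one-form with Reeb field `R`, as a cocycle of the basic
complex of the foliation generated by `R`. -/
def dReeb {lam : FormField E M 1} {R : ∀ x : M, TangentSpace 𝓘(ℝ, E) x} (hlam : IsSmoothForm lam)
    (hR : IsReebField lam R) : basicCocycles (lineFoliation R) 2 :=
  ⟨⟨extDer lam, hlam.extDer, fun x Y hY => by
    obtain ⟨c, rfl⟩ := Submodule.mem_span_singleton.mp hY
    constructor
    · refine (contract_smul_left c (R x) _).trans ?_
      have h := (hR x).2
      simp only [contractAt] at h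
      rw [h, smul_zero]
    · rw [extDer_extDer hlam]
      exact contract_zero _⟩,
    Subtype.ext (extDer_extDer hlam)⟩

end Contact

end BasicCoh

end

/-! Suppose `dλ = dβ` with `β` basic, and put `η = λ - β`. Then `η` is closed, `η(R) = 1`, `β(R) =
0` and `ι_R dβ = 0`. The contact condition makes the bilinear form `B = η ⊗ η + dβ` nondegenerate
(`eq_zero_of_wedge_ne_zero`), so there is a unique vector field `Z` with `η(Z) = 0` and `ι_Z dβ =
β`.

By Cartan's formula `L_Z η = 0` and `L_Z dβ = dβ`, hence `L_Z B = B - η ⊗ η`. In dimension `m = 2n +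
1` the density `|det B|^(1/2)` is therefore expanded by `Z` at the rate `tr (B⁻¹ L_Z B) / 2 = (m -
1) / 2 = n` (`divergence_detDensity`). On a closed manifold the integral of a divergence is zero, so
the total volume would vanish when `n ≥ 1`, which is absurd (`not_constant_divergence`).

This is the usual argument that the volume form `η ∧ (dβ)^n` would be exact. With the density `|det
B|^(1/2)` in its place, neither an orientation nor Stokes' theorem for forms is needed: the change
of variables formula and integration by parts in charts suffice. -/

noncomputable section

namespace BasicCoh

/-! ### Vectors annihilated by the factors of a top-degree wedge product. -/

section WedgeAlgebra

variable {V W : Type*} [AddCommGroup V] [Module ℝ V] [AddCommGroup W] [Module ℝ W]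

theorem wedge_compLinearMap {p q : ℕ} (a : V [⋀^Fin p]→ₗ[ℝ] ℝ) (b : V [⋀^Fin q]→ₗ[ℝ] ℝ)
    (P : W →ₗ[ℝ] V) :
    (wedge a b).compLinearMap P = wedge (a.compLinearMap P) (b.compLinearMap P) := by
  ext v
  simp only [wedge, AlternatingMap.compLinearMap_apply, AlternatingMap.domDomCongr_apply,
    LinearMap.compAlternatingMap_apply, AlternatingMap.domCoprod_apply, sum_apply]
  congr 1
  refine Finset.sum_congr rfl fun σ _ => ?_
  induction σ using Quotient.inductionOn'
  rfl

theorem wedgePow_compLinearMap {k : ℕ} (b : V [⋀^Fin k]→ₗ[ℝ] ℝ) (P : W →ₗ[ℝ] V) (n : ℕ) :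
    (wedgePow b n).compLinearMap P = wedgePow (b.compLinearMap P) n := by
  induction n with
  | zero => ext v; simp [wedgePow]
  | succ n ih => rw [wedgePow, wedge_compLinearMap, ih, wedgePow]

/-- A form killed by `w` cannot see changes of its arguments by multiples of `w`. When `g w = 1` the
map is the projection along `w`, so the form descends to the quotient by `w`. -/
theorem eq_compLinearMap_of_curryLeft_eq_zero {k : ℕ} (a : V [⋀^Fin (k + 1)]→ₗ[ℝ] ℝ) {w : V}
    (ha : a.curryLeft w = 0) (g : V →ₗ[ℝ] ℝ) :
    a.compLinearMap (LinearMap.id - g.smulRight w) = a := by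
  -- The contraction only concerns slot `0`; a transposition brings any other slot there at the cost
  -- of a sign.
  have hzero : ∀ (v : Fin (k + 1) → V) (i : Fin (k + 1)), v i = w → a v = 0 := by
    intro v i hi
    rcases Fin.eq_zero_or_eq_succ i with rfl | ⟨j, rfl⟩
    · have h := congrArg (fun c => c (Matrix.vecTail v)) ha
      simp only [AlternatingMap.curryLeft_apply_apply, AlternatingMap.zero_apply] at h
      rw [← h, ← hi]
      congr 1
      exact (Matrix.cons_head_tail v).symm
    · have hs : a (v ∘ Equiv.swap 0 j.succ) = -a v := a.map_swap v (Fin.succ_ne_zero j).symm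
      have h := congrArg (fun c => c (Matrix.vecTail (v ∘ Equiv.swap 0 j.succ))) ha
      simp only [AlternatingMap.curryLeft_apply_apply, AlternatingMap.zero_apply] at h
      have h0 : w = Matrix.vecHead (v ∘ Equiv.swap 0 j.succ) := by
        simp [Matrix.vecHead, hi]
      rw [h0, Matrix.cons_head_tail, hs] at h
      linarith
  ext v
  -- The arguments are modified one slot at a time, `s` being the set of slots already modified.
  have key : ∀ s : Finset (Fin (k + 1)),
      a (fun i => if i ∈ s then v i - g (v i) • w else v i) = a v := by
    intro s
    induction s using Finset.induction_on with
    | empty => simp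
    | insert i s hi ih =>
      have hfun : (fun j => if j ∈ insert i s then v j - g (v j) • w else v j) =
          Function.update (fun j => if j ∈ s then v j - g (v j) • w else v j) i
            (v i - g (v i) • w) := by
        funext j
        by_cases hj : j = i
        · subst hj; simp
        · simp [hj]
      rw [hfun, AlternatingMap.map_update_sub, AlternatingMap.map_update_smul,
        hzero (Function.update _ i w) i (by simp), smul_zero, sub_zero]
      rw [← ih]
      congr 1
      funext j
      by_cases hj : j = i
      · subst hj; simp [hi]
      · simp [hj]
  simpa using key Finset.univ

/-- A form of top degree vanishes if it is a pullback along a non-injective map. -/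
theorem compLinearMap_eq_zero_of_not_injective {d : ℕ} [FiniteDimensional ℝ V]
    (hd : Module.finrank ℝ V = d) (c : V [⋀^Fin d]→ₗ[ℝ] ℝ) (P : V →ₗ[ℝ] V) {w : V} (hw : w ≠ 0)
    (hP : P w = 0) : c.compLinearMap P = 0 := by
  ext v
  simp only [AlternatingMap.compLinearMap_apply, AlternatingMap.zero_apply]
  -- If the `d` vectors `P (v i)` were independent they would span, so `P` would be surjective and
  -- hence injective.
  refine c.map_linearDependent _ fun hli => hw ?_
  have hspan := hli.span_eq_top_of_card_eq_finrank' (by simp [hd])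
  have hsurj : Function.Surjective P := by
    rw [← LinearMap.range_eq_top, eq_top_iff, ← hspan, Submodule.span_le]
    rintro _ ⟨i, rfl⟩
    exact ⟨v i, rfl⟩
  exact (LinearMap.injective_iff_surjective.mpr hsurj) (hP.trans P.map_zero.symm)

/-- If `a ∧ b ^ n` is a nonzero form of top degree then no nonzero vector is annihilated by both
`a` and `b`. -/
theorem eq_zero_of_wedge_ne_zero {n : ℕ} [FiniteDimensional ℝ V]
    (hd : Module.finrank ℝ V = 1 + 2 * n) (a : V [⋀^Fin 1]→ₗ[ℝ] ℝ) (b : V [⋀^Fin 2]→ₗ[ℝ] ℝ)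
    (hab : wedge a (wedgePow b n) ≠ 0) {w : V} (ha : a.curryLeft w = 0)
    (hb : b.curryLeft w = 0) : w = 0 := by
  by_contra hw
  obtain ⟨g, hg⟩ := Module.Projective.exists_dual_ne_zero ℝ hw
  -- The normalisation `g' w = 1` makes `v ↦ v - g' v • w` kill `w`. Both forms, and so their wedge
  -- product, are pullbacks along this map.
  set g' : V →ₗ[ℝ] ℝ := (g w)⁻¹ • g
  have hg' : g' w = 1 := by simp [g', hg]
  apply hab
  rw [← eq_compLinearMap_of_curryLeft_eq_zero a ha g',
    ← eq_compLinearMap_of_curryLeft_eq_zero b hb g', ← wedgePow_compLinearMap,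
    ← wedge_compLinearMap]
  exact compLinearMap_eq_zero_of_not_injective hd _ _ hw (by simp [hg'])

end WedgeAlgebra

/-! ### Divergence of `Z` for the density `|det B|^(1/2)` in coordinates. -/

section LocalCalculus

variable {E : Type*} [NormedAddCommGroup E] [NormedSpace ℝ E] {ι : Type*} [Fintype ι]

/-- The Lie derivative of `h ⊗ h + W` along `Z`, in components. -/
theorem lie_components {h Z : ι → ℝ} {W dh dZ db : ι → ι → ℝ} {dW : ι → ι → ι → ℝ}
    (hdh : ∀ i j, dh i j = dh j i) (hW : ∀ i j, W i j = db i j - db j i)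
    (hdW : ∀ k i j, dW k i j = -dW k j i)
    (hcl : ∀ i j k, dW k i j + dW i j k + dW j k i = 0)
    (h1 : ∀ i j, ∑ k, (dZ i k * W k j + Z k * dW i k j) = db i j)
    (h2 : ∀ i, ∑ k, (dZ i k * h k + Z k * dh i k) = 0) (i j : ι) :
    ∑ k, Z k * (dh k i * h j + h i * dh k j + dW k i j) + ∑ k, dZ i k * (h k * h j + W k j) +
      ∑ k, (h i * h k + W i k) * dZ j k = W i j := by
  -- Cartan's formula in components, the first index of `dh`, `dZ`, `db` being the differentiation.
  -- Closedness of `h` and `W` rearranges the Lie derivative into derivatives of `h(Z)` and the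
  -- exterior derivative of `ι_Z W`.
  have key : ∑ k, Z k * (dh k i * h j + h i * dh k j + dW k i j) +
      ∑ k, dZ i k * (h k * h j + W k j) + ∑ k, (h i * h k + W i k) * dZ j k =
      h j * ∑ k, (dZ i k * h k + Z k * dh i k) + h i * ∑ k, (dZ j k * h k + Z k * dh j k) +
      (∑ k, (dZ i k * W k j + Z k * dW i k j) - ∑ k, (dZ j k * W k i + Z k * dW j k i)) := by
    simp only [Finset.mul_sum, ← Finset.sum_add_distrib, ← Finset.sum_sub_distrib]
    refine Finset.sum_congr rfl fun k _ => ?_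
    linear_combination Z k * h j * hdh k i + Z k * h i * hdh k j + dZ j k * hW i k
      + dZ j k * hW k i + Z k * hcl i j k - Z k * hdW i k j
  rw [key, h2, h2, h1, h1, hW]
  ring

variable [DecidableEq ι]

/-- Jacobi's formula for the derivative of a determinant. -/
theorem hasFDerivAt_det {B : E → Matrix ι ι ℝ} {B' : ι → ι → E →L[ℝ] ℝ} {y : E}
    (h : ∀ i j, HasFDerivAt (fun z => B z i j) (B' i j) y) :
    HasFDerivAt (fun z => (B z).det) (∑ i, ∑ j, (B y).adjugate i j • B' j i) y := by
  simp only [Matrix.det_apply']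
  have h1 : HasFDerivAt (fun z => ∑ σ : Equiv.Perm ι, ((Equiv.Perm.sign σ : ℤ) : ℝ) *
      ∏ i, B z (σ i) i) (∑ σ : Equiv.Perm ι, ((Equiv.Perm.sign σ : ℤ) : ℝ) •
      ∑ i, (∏ j ∈ Finset.univ.erase i, B y (σ j) j) • B' (σ i) i) y :=
    HasFDerivAt.fun_sum fun σ _ => (HasFDerivAt.finsetProd fun i _ => h (σ i) i).const_mul _
  refine h1.congr_fderiv ?_
  ext v
  simp only [sum_apply, smul_apply, smul_eq_mul]
  -- By Cramer's rule the left side is the determinant with column `i` replaced by its derivative,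
  -- which is the `i`-th group of terms in the Leibniz rule.
  have h2 : ∀ i, ∑ j, (B y).adjugate i j * B' j i v =
      ∑ σ : Equiv.Perm ι, ((Equiv.Perm.sign σ : ℤ) : ℝ) *
        ((∏ j ∈ Finset.univ.erase i, B y (σ j) j) * B' (σ i) i v) := by
    intro i
    have h3 := congrFun (Matrix.cramer_eq_adjugate_mulVec (B y) fun j => B' j i v) i
    rw [Matrix.cramer_apply, Matrix.det_apply'] at h3
    refine (Eq.symm h3).trans (Finset.sum_congr rfl fun σ _ => ?_)
    rw [← Finset.prod_erase_mul _ _ (Finset.mem_univ i)]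
    congr 2
    · refine Finset.prod_congr rfl fun j hj => ?_
      rw [Matrix.updateCol_ne (Finset.ne_of_mem_erase hj)]
    · rw [Matrix.updateCol_self]
  rw [Finset.sum_congr rfl fun i _ => h2 i, Finset.sum_comm]
  simp only [Finset.mul_sum]

/-- If `A + J B + B Jᵀ = B - h hᵀ` where `B r = h` and `⟨h, r⟩ = 1`, then
`tr (B⁻¹ A) + 2 tr J = m - 1`. -/
theorem trace_lie {A J B : Matrix ι ι ℝ} {h r : ι → ℝ} (hB : IsUnit B.det)
    (hA : A + J * B + B * J.transpose = B - Matrix.vecMulVec h h) (hr : B.mulVec r = h)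
    (hhr : h ⬝ᵥ r = 1) : (B⁻¹ * A).trace + 2 * J.trace = Fintype.card ι - 1 := by
  -- This gives `tr (B⁻¹ h hᵀ) = ⟨r, h⟩ = 1`, the defect in `m - 1`. Each of the two `J` terms
  -- contributes `tr J` by cyclicity.
  have hr' : B⁻¹.mulVec h = r := by
    rw [← hr, Matrix.mulVec_mulVec, Matrix.nonsing_inv_mul _ hB, Matrix.one_mulVec]
  have h1 := congrArg (fun X => (B⁻¹ * X).trace) hA
  simp only [Matrix.mul_add, Matrix.mul_sub, Matrix.trace_add, Matrix.trace_sub] at h1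
  rw [Matrix.nonsing_inv_mul _ hB, Matrix.trace_one, Matrix.nonsing_inv_mul_cancel_left _ _ hB,
    Matrix.trace_transpose, Matrix.trace_mul_comm B⁻¹ (J * B), Matrix.mul_assoc,
    Matrix.mul_nonsing_inv _ hB, Matrix.mul_one, Matrix.mul_vecMulVec, hr',
    Matrix.trace_vecMulVec, dotProduct_comm, hhr] at h1
  linarith

/-- The matrix of the bilinear form `h ⊗ h + W`. -/
def sqAddMatrix (h : ι → E → ℝ) (W : ι → ι → E → ℝ) (z : E) : Matrix ι ι ℝ :=
  Matrix.of fun i j => h i z * h j z + W i j z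

/-- The density `|det B| ^ (1 / 2)` of a family of invertible matrices. -/
def detDensity (B : E → Matrix ι ι ℝ) (z : E) : ℝ := Real.exp (Real.log (B z).det / 2)

/-- The logarithmic derivative is `tr (B⁻¹ dB) / 2`. Since `Real.log` is `log |·|`, the sign of the
determinant plays no role. -/
theorem fderiv_detDensity {B : E → Matrix ι ι ℝ} {B' : ι → ι → E →L[ℝ] ℝ} {y : E}
    (h : ∀ i j, HasFDerivAt (fun z => B z i j) (B' i j) y) (hB : (B y).det ≠ 0) :
    HasFDerivAt (detDensity B)
      ((detDensity B y / 2) • ∑ i, ∑ j, (B y)⁻¹ i j • B' j i) y := by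
  have h1 := (((hasFDerivAt_det h).log hB).mul_const (1 / 2 : ℝ)).exp
  have h2 : HasFDerivAt (detDensity B) _ y :=
    h1.congr_of_eventuallyEq (Filter.Eventually.of_forall fun z => by
      simp only [detDensity, div_eq_mul_inv, one_mul])
  refine h2.congr_fderiv ?_
  ext v
  simp only [smul_apply, sum_apply, smul_eq_mul, detDensity, Matrix.inv_def, Matrix.smul_apply,
    Ring.inverse_eq_inv', mul_assoc, ← Finset.mul_sum]
  simp only [div_eq_mul_inv, one_mul]
  ring

/-- Let `W` be the exterior derivative of `β` and let `Z` be a vector field with `ι_Z W = β` and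
`h Z = 0`, where `h` is closed. Then `Z` expands the density of `h ⊗ h + W` at a constant rate. -/
theorem divergence_detDensity {β h Z : ι → E → ℝ} {W : ι → ι → E → ℝ} {e : ι → E} {y : E}
    {r : ι → ℝ} (hhd : ∀ i, DifferentiableAt ℝ (h i) y)
    (hZd : ∀ i, DifferentiableAt ℝ (Z i) y) (hWd : ∀ i j, DifferentiableAt ℝ (W i j) y)
    (hdh : ∀ i j, fderiv ℝ (h j) y (e i) = fderiv ℝ (h i) y (e j))
    (hW : ∀ i j, W i j y = fderiv ℝ (β j) y (e i) - fderiv ℝ (β i) y (e j))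
    (hanti : ∀ i j z, W i j z = -W j i z)
    (hcl : ∀ i j k, fderiv ℝ (W i j) y (e k) + fderiv ℝ (W j k) y (e i) +
      fderiv ℝ (W k i) y (e j) = 0)
    (hZW : ∀ j, ∀ᶠ z in 𝓝 y, ∑ k, Z k z * W k j z = β j z)
    (hZh : ∀ᶠ z in 𝓝 y, ∑ k, Z k z * h k z = 0)
    (hr : ∑ j, h j y * r j = 1) (hWr : ∀ i, ∑ j, W i j y * r j = 0)
    (hdet : (sqAddMatrix h W y).det ≠ 0) :
    ∑ k, fderiv ℝ (fun z => detDensity (sqAddMatrix h W) z * Z k z) y (e k) =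
      (Fintype.card ι - 1) / 2 * detDensity (sqAddMatrix h W) y := by
  have hB : ∀ i j, HasFDerivAt (fun z => sqAddMatrix h W z i j)
      (h i y • fderiv ℝ (h j) y + h j y • fderiv ℝ (h i) y + fderiv ℝ (W i j) y) y := fun i j =>
    ((hhd i).hasFDerivAt.mul (hhd j).hasFDerivAt).add (hWd i j).hasFDerivAt
  have hf := fderiv_detDensity hB hdet
  have h1 : ∀ i j, ∑ k, (fderiv ℝ (Z k) y (e i) * W k j y + Z k y * fderiv ℝ (W k j) y (e i)) =
      fderiv ℝ (β j) y (e i) := by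
    intro i j
    have hs : HasFDerivAt (fun z => ∑ k, Z k z * W k j z) _ y := HasFDerivAt.fun_sum
      fun k _ => (hZd k).hasFDerivAt.mul (hWd k j).hasFDerivAt
    rw [← Filter.EventuallyEq.fderiv_eq (hZW j), hs.fderiv]
    simp only [sum_apply, add_apply, smul_apply, smul_eq_mul]
    exact Finset.sum_congr rfl fun k _ => by ring
  have h2 : ∀ i, ∑ k, (fderiv ℝ (Z k) y (e i) * h k y + Z k y * fderiv ℝ (h k) y (e i)) = 0 := by
    intro i
    have hs : HasFDerivAt (fun z => ∑ k, Z k z * h k z) _ y := HasFDerivAt.fun_sum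
      fun k _ => (hZd k).hasFDerivAt.mul (hhd k).hasFDerivAt
    have h0 : fderiv ℝ (fun z => ∑ k, Z k z * h k z) y = 0 := by
      rw [Filter.EventuallyEq.fderiv_eq (f₁ := fun z => ∑ k, Z k z * h k z) (f := fun _ => (0 : ℝ))
        hZh]
      simp
    rw [hs.fderiv] at h0
    have h3 := congrArg (fun L => L (e i)) h0
    simp only [sum_apply, add_apply, smul_apply, smul_eq_mul, zero_apply] at h3
    rw [← h3]
    exact Finset.sum_congr rfl fun k _ => by ring
  have hantid : ∀ k i j, fderiv ℝ (W i j) y (e k) = -fderiv ℝ (W j i) y (e k) := by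
    intro k i j
    rw [show W i j = fun z => -W j i z from funext (hanti i j), fderiv_fun_neg]
    rfl
  have hlie := lie_components (h := fun k => h k y) (Z := fun k => Z k y)
    (W := fun i j => W i j y) (dh := fun i j => fderiv ℝ (h j) y (e i))
    (dZ := fun i k => fderiv ℝ (Z k) y (e i)) (db := fun i j => fderiv ℝ (β j) y (e i))
    (dW := fun k i j => fderiv ℝ (W i j) y (e k)) hdh hW hantid hcl h1 h2
  set B := sqAddMatrix h W y with hBdef
  let J : Matrix ι ι ℝ := Matrix.of fun i k => fderiv ℝ (Z k) y (e i)
  let A : Matrix ι ι ℝ := Matrix.of fun i j => ∑ k, Z k y * (fderiv ℝ (h i) y (e k) * h j y +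
    h i y * fderiv ℝ (h j) y (e k) + fderiv ℝ (W i j) y (e k))
  -- `A` is the derivative of the coefficients of `B` along `Z` and `J` the Jacobian of `Z`, so that
  -- `A + J B + B Jᵀ` is `L_Z B = W = B - h hᵀ`.
  have htr := trace_lie (A := A) (J := J) (B := B) (h := fun k => h k y) (r := r)
    (isUnit_iff_ne_zero.mpr hdet) (by
      ext i j
      simp only [Matrix.add_apply, Matrix.sub_apply, Matrix.mul_apply, Matrix.transpose_apply,
        Matrix.vecMulVec_apply, A, J, hBdef, sqAddMatrix, Matrix.of_apply, hlie]
      ring) (by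
      ext i
      simp only [Matrix.mulVec, dotProduct, hBdef, sqAddMatrix, Matrix.of_apply, add_mul,
        Finset.sum_add_distrib, hWr, mul_assoc, ← Finset.mul_sum, hr]
      ring) hr
  have hk : ∀ k, fderiv ℝ (fun z => detDensity (sqAddMatrix h W) z * Z k z) y (e k) =
      detDensity (sqAddMatrix h W) y * fderiv ℝ (Z k) y (e k) +
      Z k y * (detDensity (sqAddMatrix h W) y / 2 * ∑ i, ∑ j, B⁻¹ i j *
        (h j y * fderiv ℝ (h i) y (e k) + h i y * fderiv ℝ (h j) y (e k) +
          fderiv ℝ (W j i) y (e k))) := by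
    intro k
    rw [(hf.fun_mul (hZd k).hasFDerivAt).fderiv]
    simp only [add_apply, smul_apply, smul_eq_mul, sum_apply, hBdef]
  have hA : (B⁻¹ * A).trace = ∑ k, Z k y * ∑ i, ∑ j, B⁻¹ i j *
        (h j y * fderiv ℝ (h i) y (e k) + h i y * fderiv ℝ (h j) y (e k) +
          fderiv ℝ (W j i) y (e k)) := by
    simp only [Matrix.trace, Matrix.diag_apply, Matrix.mul_apply, A, Matrix.of_apply,
      Finset.mul_sum]
    rw [Finset.sum_comm]
    conv_rhs => rw [Finset.sum_comm]
    rw [Finset.sum_comm]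
    refine Finset.sum_congr rfl fun i _ => ?_
    rw [Finset.sum_comm]
    refine Finset.sum_congr rfl fun k _ => Finset.sum_congr rfl fun j _ => ?_
    ring
  rw [Finset.sum_congr rfl fun k _ => hk k, Finset.sum_add_distrib, ← Finset.mul_sum]
  have hJ : J.trace = ∑ k, fderiv ℝ (Z k) y (e k) := rfl
  rw [← hJ, Finset.sum_congr rfl fun k _ => mul_left_comm (Z k y)
    (detDensity (sqAddMatrix h W) y / 2) _, ← Finset.mul_sum, ← hA]
  -- With `f` the density, the divergence of `f Z` is `f tr J + (f / 2) tr (B⁻¹ A)`.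
  linear_combination detDensity (sqAddMatrix h W) y / 2 * htr

end LocalCalculus

/-! ### Integration of densities in charts and the divergence theorem on a closed manifold. -/

section Integration

open MeasureTheory Set

/-- The extension by zero vanishes near every point outside `K`, so the behaviour of `G` at the
boundary of `U` is irrelevant. -/
theorem contDiff_indicator_of_isCompact {E F : Type*} [NormedAddCommGroup E] [NormedSpace ℝ E]
    [NormedAddCommGroup F] [NormedSpace ℝ F] {U K : Set E} {G : E → F} {n : WithTop ℕ∞}
    (hU : IsOpen U) (hK : IsCompact K) (hKU : K ⊆ U) (hG : ContDiffOn ℝ n G U)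
    (h0 : ∀ y ∈ U, y ∉ K → G y = 0) :
    ContDiff ℝ n (U.indicator G) ∧ tsupport (U.indicator G) ⊆ K := by
  have hsupp : tsupport (U.indicator G) ⊆ K := by
    refine closure_minimal (fun y hy => ?_) hK.isClosed
    by_contra hyK
    apply hy
    by_cases hyU : y ∈ U
    · rw [indicator_of_mem hyU, h0 y hyU hyK]
    · rw [indicator_of_notMem hyU]
  refine ⟨contDiff_iff_contDiffAt.mpr fun y => ?_, hsupp⟩
  by_cases hy : y ∉ tsupport (U.indicator G)
  · exact contDiffAt_const.congr_of_eventuallyEq (notMem_tsupport_iff_eventuallyEq.mp hy)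
  rw [not_not] at hy
  have hyU := hU.mem_nhds (hKU (hsupp hy))
  exact (hG.contDiffAt hyU).congr_of_eventuallyEq
    (Filter.eventuallyEq_of_mem hyU fun z hz => indicator_of_mem hz G)

/-- Integration by parts against the constant function `1`. -/
theorem integral_fderiv_eq_zero_of_hasCompactSupport {E : Type*} [NormedAddCommGroup E]
    [NormedSpace ℝ E] [FiniteDimensional ℝ E] [MeasurableSpace E] [BorelSpace E] (μ : Measure E)
    [μ.IsAddHaarMeasure] {u : E → ℝ} (hu : ContDiff ℝ 1 u) (hc : HasCompactSupport u) (v : E) :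
    ∫ y, fderiv ℝ u y v ∂μ = 0 := by
  have hi : Integrable (fun y => fderiv ℝ u y v) μ :=
    ((hu.continuous_fderiv (by simp)).clm_apply continuous_const).integrable_of_hasCompactSupport
      (hc.fderiv_apply ℝ v)
  have hi' : Integrable u μ := hu.continuous.integrable_of_hasCompactSupport hc
  have h := integral_mul_fderiv_eq_neg_fderiv_mul_of_integrable (μ := μ) (f := fun _ : E => (1 : ℝ))
    (g := u) (v := v) (by simp) (by simpa using hi) (by simpa using hi') (by simp)
    (fun y _ => hu.differentiable (by simp) y)
  simpa using h

variable {E : Type*} [NormedAddCommGroup E] [NormedSpace ℝ E]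
  {M : Type*} [TopologicalSpace M] [ChartedSpace E M]

/-- The coefficient `f` may be unbounded near the edge of the chart; the factor `g` confines the
integrand to the compact image of `T`. -/
theorem integrableOn_chart {E M : Type*} [NormedAddCommGroup E] [MeasurableSpace E] [BorelSpace E]
    [TopologicalSpace M] [ChartedSpace E M] [CompactSpace M] (μ : Measure E)
    [IsFiniteMeasureOnCompacts μ] (x₀ : M)
    {g : M → ℝ} {f : E → ℝ} {T : Set M} (hT : IsClosed T) (hTs : T ⊆ (chartAt E x₀).source)
    (hgT : ∀ x ∉ T, g x = 0)
    (hg : ContinuousOn (fun y => g ((chartAt E x₀).symm y)) (chartAt E x₀).target)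
    (hf : ContinuousOn f (chartAt E x₀).target) :
    IntegrableOn (fun y => g ((chartAt E x₀).symm y) * f y) (chartAt E x₀).target μ := by
  have hK : IsCompact (chartAt E x₀ '' T) :=
    hT.isCompact.image_of_continuousOn ((chartAt E x₀).continuousOn.mono hTs)
  have hKU : chartAt E x₀ '' T ⊆ (chartAt E x₀).target := by
    rintro _ ⟨x, hx, rfl⟩
    exact (chartAt E x₀).map_source (hTs hx)
  refine (((hg.mul hf).mono hKU).integrableOn_compact hK).of_forall_sdiff_eq_zero
    (chartAt E x₀).open_target.measurableSet fun y hy => ?_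
  change g _ * f y = 0
  rw [hgT _ fun h => hy.2 ⟨_, h, (chartAt E x₀).right_inv hy.1⟩, zero_mul]

/-- The coordinate expression of a vector field in the chart at `x₀`. -/
def chartVec (Z : ∀ x : M, TangentSpace 𝓘(ℝ, E) x) (x₀ : M) (y : E) : E :=
  mfderiv 𝓘(ℝ, E) 𝓘(ℝ, E) (chartAt E x₀) ((chartAt E x₀).symm y) (Z ((chartAt E x₀).symm y))

/-- The derivative of a function along a vector field. -/
def dirDeriv (Z : ∀ x : M, TangentSpace 𝓘(ℝ, E) x) (g : M → ℝ) (x : M) : ℝ :=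
  mfderiv 𝓘(ℝ, E) 𝓘(ℝ, ℝ) g x (Z x)

theorem dirDeriv_eq_zero_of_notMem_tsupport (Z : ∀ x : M, TangentSpace 𝓘(ℝ, E) x) {g : M → ℝ}
    {x : M} (hx : x ∉ tsupport g) : dirDeriv Z g x = 0 := by
  have h : g =ᶠ[𝓝 x] fun _ => 0 := notMem_tsupport_iff_eventuallyEq.mp hx
  rw [dirDeriv, h.mfderiv_eq, mfderiv_const]
  rfl

variable [IsManifold 𝓘(ℝ, E) ∞ M]

theorem contDiffOn_comp_chart_symm {g : M → ℝ} (hg : ContMDiff 𝓘(ℝ, E) 𝓘(ℝ, ℝ) ∞ g) (x₀ : M) :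
    ContDiffOn ℝ ∞ (g ∘ (chartAt E x₀).symm) (chartAt E x₀).target := by
  rw [← contMDiffOn_iff_contDiffOn]
  exact hg.comp_contMDiffOn (contMDiffOn_chart_symm (I := 𝓘(ℝ, E)) (n := ∞) (x := x₀))

theorem dirDeriv_chart_symm (Z : ∀ x : M, TangentSpace 𝓘(ℝ, E) x) {g : M → ℝ}
    (hg : ContMDiff 𝓘(ℝ, E) 𝓘(ℝ, ℝ) ∞ g) (x₀ : M) {y : E} (hy : y ∈ (chartAt E x₀).target) :
    dirDeriv Z g ((chartAt E x₀).symm y) =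
      fderiv ℝ (g ∘ (chartAt E x₀).symm) y (chartVec Z x₀ y) := by
  have hx : (chartAt E x₀).symm y ∈ (chartAt E x₀).source := (chartAt E x₀).map_target hy
  have hr : chartAt E x₀ ((chartAt E x₀).symm y) = y := (chartAt E x₀).right_inv hy
  have hev : g =ᶠ[𝓝 ((chartAt E x₀).symm y)] (g ∘ (chartAt E x₀).symm) ∘ chartAt E x₀ := by
    filter_upwards [(chartAt E x₀).open_source.mem_nhds hx] with z hz
    simp [(chartAt E x₀).left_inv hz]
  have hd : MDifferentiableAt 𝓘(ℝ, E) 𝓘(ℝ, ℝ) (g ∘ (chartAt E x₀).symm)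
      (chartAt E x₀ ((chartAt E x₀).symm y)) := by
    rw [hr]
    exact (((contDiffOn_comp_chart_symm hg x₀).contDiffAt
      ((chartAt E x₀).open_target.mem_nhds hy)).differentiableAt (by simp)).mdifferentiableAt
  rw [dirDeriv, hev.mfderiv_eq, mfderiv_comp _ hd (mdifferentiableAt_chart_aux x₀ hx),
    mfderiv_eq_fderiv, hr]
  rfl

theorem sum_dirDeriv_eq_zero (Z : ∀ x : M, TangentSpace 𝓘(ℝ, E) x) {κ : Type*} [Fintype κ]
    {ρ : κ → M → ℝ} (hρ : ∀ i, ContMDiff 𝓘(ℝ, E) 𝓘(ℝ, ℝ) ∞ (ρ i)) (hsum : ∀ x, ∑ i, ρ i x = 1)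
    (x : M) : ∑ i, dirDeriv Z (ρ i) x = 0 := by
  have hy := mem_chart_target E x
  have h : ∀ i, dirDeriv Z (ρ i) x = fderiv ℝ (ρ i ∘ (chartAt E x).symm) (chartAt E x x)
      (chartVec Z x (chartAt E x x)) := fun i => by
    rw [← dirDeriv_chart_symm Z (hρ i) x hy, (chartAt E x).left_inv (mem_chart_source E x)]
  have hs : HasFDerivAt (fun y => ∑ i, (ρ i ∘ (chartAt E x).symm) y)
      (∑ i, fderiv ℝ (ρ i ∘ (chartAt E x).symm) (chartAt E x x)) (chartAt E x x) :=
    HasFDerivAt.fun_sum fun i _ => (((contDiffOn_comp_chart_symm (hρ i) x).contDiffAt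
      ((chartAt E x).open_target.mem_nhds hy)).differentiableAt (by simp)).hasFDerivAt
  have h1 : (fun y => ∑ i, (ρ i ∘ (chartAt E x).symm) y) = fun _ => (1 : ℝ) :=
    funext fun y => hsum _
  rw [h1] at hs
  rw [Finset.sum_congr rfl fun i _ => h i, ← sum_apply, ← hs.fderiv]
  simp

variable [FiniteDimensional ℝ E] [MeasurableSpace E] [BorelSpace E]

/-- The integral of a function over the chart at `x₀` against the density with coefficients `f`. -/
def chartIntegral (μ : Measure E) (f : M → E → ℝ) (x₀ : M) (g : M → ℝ) : ℝ :=
  ∫ y in (chartAt E x₀).target, g ((chartAt E x₀).symm y) * f x₀ y ∂μ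

/-- The coefficients `f` transform as those of a density. -/
def IsDensity (f : M → E → ℝ) : Prop :=
  ∀ x₀ x₁ : M, ∀ y ∈ (chartAt E x₀).target, (chartAt E x₀).symm y ∈ (chartAt E x₁).source →
    f x₀ y = |(fderiv ℝ (chartAt E x₁ ∘ (chartAt E x₀).symm) y).det| *
      f x₁ ((chartAt E x₁ ∘ (chartAt E x₀).symm) y)

/-- Change of variables on the overlap of the two charts: the absolute Jacobian is exactly the
transformation factor of a density. -/
theorem chartIntegral_eq (μ : Measure E) [μ.IsAddHaarMeasure] {f : M → E → ℝ} (hf : IsDensity f)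
    (x₀ x₁ : M) {g : M → ℝ}
    (hg : ∀ x, g x ≠ 0 → x ∈ (chartAt E x₀).source ∧ x ∈ (chartAt E x₁).source) :
    chartIntegral μ f x₀ g = chartIntegral μ f x₁ g := by
  set φ := chartAt E x₀
  set ψ := chartAt E x₁
  set S := (φ.symm.trans ψ).source with hS
  have hSmem : ∀ y, y ∈ S ↔ y ∈ φ.target ∧ φ.symm y ∈ ψ.source := fun y => by
    simp [hS]
  have hTmem : ∀ y, y ∈ (ψ ∘ φ.symm) '' S ↔ y ∈ ψ.target ∧ ψ.symm y ∈ φ.source := by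
    intro y
    constructor
    · rintro ⟨z, hz, rfl⟩
      rw [hSmem] at hz
      refine ⟨ψ.map_source hz.2, ?_⟩
      simpa [ψ.left_inv hz.2] using φ.map_target hz.1
    · rintro ⟨hy, hy'⟩
      refine ⟨φ (ψ.symm y), (hSmem _).2 ⟨φ.map_source hy', ?_⟩, ?_⟩
      · rw [φ.left_inv hy']; exact ψ.map_target hy
      · simp [φ.left_inv hy', ψ.right_inv hy]
  have hSm : MeasurableSet S := (φ.symm.trans ψ).open_source.measurableSet
  have hinj : InjOn (ψ ∘ φ.symm) S := (φ.symm.trans ψ).injOn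
  have h0 : chartIntegral μ f x₀ g = ∫ y in S, g (φ.symm y) * f x₀ y ∂μ := by
    refine setIntegral_eq_of_subset_of_forall_sdiff_eq_zero φ.open_target.measurableSet
      (fun y hy => ((hSmem y).1 hy).1) fun y hy => ?_
    by_contra hne
    exact hy.2 ((hSmem y).2 ⟨hy.1, (hg _ (left_ne_zero_of_mul hne)).2⟩)
  have h1 : chartIntegral μ f x₁ g = ∫ y in (ψ ∘ φ.symm) '' S, g (ψ.symm y) * f x₁ y ∂μ := by
    refine setIntegral_eq_of_subset_of_forall_sdiff_eq_zero ψ.open_target.measurableSet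
      (fun y hy => ((hTmem y).1 hy).1) fun y hy => ?_
    by_contra hne
    exact hy.2 ((hTmem y).2 ⟨hy.1, (hg _ (left_ne_zero_of_mul hne)).1⟩)
  rw [h0, h1, integral_image_eq_integral_abs_det_fderiv_smul μ hSm (fun y hy =>
    ((contDiffAt_transition x₀ x₁ ((hSmem y).1 hy).1 ((hSmem y).1 hy).2).differentiableAt
      (by simp)).hasFDerivAt.hasFDerivWithinAt) hinj]
  refine setIntegral_congr_fun hSm fun y hy => ?_
  have hy' := (hSmem y).1 hy
  simp only [smul_eq_mul]
  rw [hf x₀ x₁ y hy'.1 hy'.2]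
  simp only [Function.comp_apply]
  rw [ψ.left_inv hy'.2]
  ring

/-- The divergence theorem for a vector field cut off by a function supported in a chart. -/
theorem chartIntegral_dirDeriv [CompactSpace M] (μ : Measure E) [μ.IsAddHaarMeasure]
    {κ : Type*} [Fintype κ] (b : Module.Basis κ ℝ E) {f : M → E → ℝ}
    {Z : ∀ x : M, TangentSpace 𝓘(ℝ, E) x} {c : ℝ} (x₀ : M)
    (hf : ContDiffOn ℝ ∞ (f x₀) (chartAt E x₀).target)
    (hZ : ContDiffOn ℝ ∞ (chartVec Z x₀) (chartAt E x₀).target)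
    (hdiv : ∀ y ∈ (chartAt E x₀).target,
      ∑ k, fderiv ℝ (fun z => f x₀ z * b.repr (chartVec Z x₀ z) k) y (b k) = c * f x₀ y)
    {g : M → ℝ} (hg : ContMDiff 𝓘(ℝ, E) 𝓘(ℝ, ℝ) ∞ g)
    (hgs : tsupport g ⊆ (chartAt E x₀).source) :
    chartIntegral μ f x₀ (dirDeriv Z g) = -(c * chartIntegral μ f x₀ g) := by
  set φ := chartAt E x₀ with hφ
  have hK : IsCompact (φ '' tsupport g) :=
    (isClosed_tsupport g).isCompact.image_of_continuousOn (φ.continuousOn.mono hgs)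
  have hKU : φ '' tsupport g ⊆ φ.target := by
    rintro _ ⟨x, hx, rfl⟩
    exact φ.map_source (hgs hx)
  have hgc := contDiffOn_comp_chart_symm hg x₀
  have hco : ∀ k, ContDiffOn ℝ ∞ (fun y => b.repr (chartVec Z x₀ y) k) φ.target := fun k =>
    (LinearMap.toContinuousLinearMap (b.coord k)).contDiff.comp_contDiffOn hZ
  -- The components of `g f Z`. Extended by zero they have compact support, so their divergence
  -- `Z(g) f + c g f` integrates to zero.
  let u : κ → E → ℝ := fun k y => g (φ.symm y) * (f x₀ y * b.repr (chartVec Z x₀ y) k)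
  have hu : ∀ k, ContDiff ℝ ∞ (φ.target.indicator (u k)) ∧
      tsupport (φ.target.indicator (u k)) ⊆ φ '' tsupport g := fun k => by
    refine contDiff_indicator_of_isCompact φ.open_target hK hKU
      (hgc.mul (hf.mul (hco k))) fun y hy hyK => ?_
    have : g (φ.symm y) = 0 := by
      by_contra hne
      exact hyK ⟨_, subset_tsupport g hne, φ.right_inv hy⟩
    simp [u, this]
  have hint : ∀ k, ∫ y, fderiv ℝ (φ.target.indicator (u k)) y (b k) ∂μ = 0 := fun k =>
    integral_fderiv_eq_zero_of_hasCompactSupport μ ((hu k).1.of_le (by simp))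
      (hK.of_isClosed_subset (isClosed_tsupport _) (hu k).2) (b k)
  have hset : ∀ k, ∫ y in φ.target, fderiv ℝ (u k) y (b k) ∂μ = 0 := fun k => by
    have hloc : ∫ y in φ.target, fderiv ℝ (φ.target.indicator (u k)) y (b k) ∂μ =
        ∫ y, fderiv ℝ (φ.target.indicator (u k)) y (b k) ∂μ := by
      refine setIntegral_eq_integral_of_forall_compl_eq_zero fun y hy => ?_
      have h0 : φ.target.indicator (u k) =ᶠ[𝓝 y] 0 :=
        notMem_tsupport_iff_eventuallyEq.mp fun h => hy (hKU ((hu k).2 h))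
      rw [h0.fderiv_eq]
      simp
    rw [← hint k, ← hloc]
    refine setIntegral_congr_fun φ.open_target.measurableSet fun y hy => ?_
    have : φ.target.indicator (u k) =ᶠ[𝓝 y] u k :=
      Filter.eventuallyEq_of_mem (φ.open_target.mem_nhds hy) fun z hz => indicator_of_mem hz _
    simp only [this.fderiv_eq]
  have hintg : ∀ k, IntegrableOn (fun y => fderiv ℝ (u k) y (b k)) φ.target μ := fun k => by
    have h1 : Integrable (fun y => fderiv ℝ (φ.target.indicator (u k)) y (b k)) μ :=
      (((hu k).1.continuous_fderiv (by simp)).clm_apply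
        continuous_const).integrable_of_hasCompactSupport
        (HasCompactSupport.fderiv_apply ℝ
          (hK.of_isClosed_subset (isClosed_tsupport _) (hu k).2) (b k))
    refine (h1.integrableOn (s := φ.target)).congr_fun (fun y hy => ?_)
      φ.open_target.measurableSet
    have : φ.target.indicator (u k) =ᶠ[𝓝 y] u k :=
      Filter.eventuallyEq_of_mem (φ.open_target.mem_nhds hy) fun z hz => indicator_of_mem hz _
    simp only [this.fderiv_eq]
  have hpt : ∀ y ∈ φ.target, ∑ k, fderiv ℝ (u k) y (b k) =
      dirDeriv Z g (φ.symm y) * f x₀ y + c * (g (φ.symm y) * f x₀ y) := by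
    intro y hy
    have hn := φ.open_target.mem_nhds hy
    have hgd : DifferentiableAt ℝ (g ∘ φ.symm) y := (hgc.contDiffAt hn).differentiableAt (by simp)
    have hk : ∀ k, fderiv ℝ (u k) y (b k) = g (φ.symm y) *
        fderiv ℝ (fun z => f x₀ z * b.repr (chartVec Z x₀ z) k) y (b k) +
        f x₀ y * (b.repr (chartVec Z x₀ y) k * fderiv ℝ (g ∘ φ.symm) y (b k)) := fun k => by
      have h1 := hgd.hasFDerivAt.fun_mul ((((hf.mul (hco k)).contDiffAt hn).differentiableAt
        (by simp)).hasFDerivAt)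
      have h2 : fderiv ℝ (u k) y = _ := h1.fderiv
      rw [h2]
      simp only [add_apply, smul_apply, smul_eq_mul, Function.comp_apply]
      ring
    rw [Finset.sum_congr rfl fun k _ => hk k, Finset.sum_add_distrib, ← Finset.mul_sum,
      ← Finset.mul_sum, hdiv y hy, dirDeriv_chart_symm Z hg x₀ hy]
    conv_rhs => rw [← b.sum_repr (chartVec Z x₀ y)]
    simp only [map_sum, map_smul, smul_eq_mul]
    ring
  have htot : ∫ y in φ.target, ∑ k, fderiv ℝ (u k) y (b k) ∂μ = 0 := by
    rw [integral_finsetSum _ fun k _ => hintg k]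
    exact Finset.sum_eq_zero fun k _ => hset k
  have hcont : ContinuousOn (fun y => dirDeriv Z g (φ.symm y)) φ.target := by
    refine ContinuousOn.congr ?_ fun y hy => dirDeriv_chart_symm Z hg x₀ hy
    exact (hgc.continuousOn_fderiv_of_isOpen φ.open_target (by simp)).clm_apply hZ.continuousOn
  have hi1 := integrableOn_chart μ x₀ (isClosed_tsupport g) hgs
    (fun x hx => dirDeriv_eq_zero_of_notMem_tsupport Z hx) hcont hf.continuousOn
  have hi2 := integrableOn_chart μ x₀ (isClosed_tsupport g) hgs
    (fun x hx => image_eq_zero_of_notMem_tsupport hx) hgc.continuousOn hf.continuousOn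
  rw [setIntegral_congr_fun φ.open_target.measurableSet hpt, integral_add hi1 (hi2.const_mul c),
    integral_const_mul] at htot
  exact eq_neg_of_add_eq_zero_left htot

/-- On a closed manifold no vector field expands a positive density at a constant nonzero rate. -/
theorem not_constant_divergence [T2Space M] [CompactSpace M] [Nonempty M]
    {κ : Type*} [Fintype κ] (b : Module.Basis κ ℝ E) {f : M → E → ℝ}
    {Z : ∀ x : M, TangentSpace 𝓘(ℝ, E) x} {c : ℝ} (hc : c ≠ 0) (hfd : IsDensity f)
    (hpos : ∀ x₀ y, 0 < f x₀ y)
    (hf : ∀ x₀, ContDiffOn ℝ ∞ (f x₀) (chartAt E x₀).target)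
    (hZ : ∀ x₀, ContDiffOn ℝ ∞ (chartVec Z x₀) (chartAt E x₀).target)
    (hdiv : ∀ x₀, ∀ y ∈ (chartAt E x₀).target,
      ∑ k, fderiv ℝ (fun z => f x₀ z * b.repr (chartVec Z x₀ z) k) y (b k) = c * f x₀ y) :
    False := by
  let μ : Measure E := Measure.addHaar
  obtain ⟨t, ht⟩ := isCompact_univ.elim_finite_subcover (fun x : M => (chartAt E x).source)
    (fun x => (chartAt E x).open_source)
    (fun x _ => mem_iUnion.mpr ⟨x, mem_chart_source E x⟩)
  obtain ⟨ρ, hρ⟩ := SmoothPartitionOfUnity.exists_isSubordinate 𝓘(ℝ, E) (s := univ)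
    isClosed_univ (fun i : t => (chartAt E (i : M)).source) (fun i => (chartAt E (i : M)).open_source)
    (fun x hx => by
      obtain ⟨i, hi, hxi⟩ := mem_iUnion₂.mp (ht hx)
      exact mem_iUnion.mpr ⟨⟨i, hi⟩, hxi⟩)
  have hsm : ∀ i, ContMDiff 𝓘(ℝ, E) 𝓘(ℝ, ℝ) ∞ (ρ i) := fun i => (ρ i).contMDiff
  have hsum : ∀ x, ∑ i, ρ i x = 1 := fun x => by
    rw [← finsum_eq_sum_of_fintype]
    exact ρ.sum_eq_one (mem_univ x)
  have hcont : ∀ (i : t) (g : M → ℝ), ContMDiff 𝓘(ℝ, E) 𝓘(ℝ, ℝ) ∞ g →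
      ContinuousOn (fun y => dirDeriv Z g ((chartAt E (i : M)).symm y)) (chartAt E (i : M)).target := by
    intro i g hg
    refine ContinuousOn.congr ?_ fun y hy => dirDeriv_chart_symm Z hg i hy
    exact ((contDiffOn_comp_chart_symm hg i).continuousOn_fderiv_of_isOpen
      (chartAt E (i : M)).open_target (by simp)).clm_apply (hZ i).continuousOn
  -- Either the derivative of `ρ i` or the factor `ρ j` confines the integrand to the support of `ρ
  -- k`, inside chart `k`.
  have hint : ∀ k i j : t, k = i ∨ k = j → IntegrableOn (fun y =>
      (fun x => ρ j x * dirDeriv Z (ρ i) x) ((chartAt E (k : M)).symm y) * f k y)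
      (chartAt E (k : M)).target μ := by
    intro k i j hk
    refine integrableOn_chart μ (k : M) (g := fun x => ρ j x * dirDeriv Z (ρ i) x)
      (isClosed_tsupport (ρ k)) (hρ k) (fun x hx => ?_)
      ((contDiffOn_comp_chart_symm (hsm j) k).continuousOn.mul (hcont k _ (hsm i)))
      (hf k).continuousOn
    rcases hk with rfl | rfl
    · simp [dirDeriv_eq_zero_of_notMem_tsupport Z hx]
    · simp [image_eq_zero_of_notMem_tsupport hx]
  -- Insert `∑ j, ρ j = 1` and move the `j`-th piece to chart `j`. The sum over `i` can then be
  -- taken pointwise in a single chart, where `∑ i, Z(ρ i) = 0`.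
  have h1 : ∀ i : t, chartIntegral μ f i (dirDeriv Z (ρ i)) =
      ∑ j : t, chartIntegral μ f j (fun x => ρ j x * dirDeriv Z (ρ i) x) := by
    intro i
    have : chartIntegral μ f i (dirDeriv Z (ρ i)) =
        ∑ j : t, chartIntegral μ f i (fun x => ρ j x * dirDeriv Z (ρ i) x) := by
      simp only [chartIntegral]
      rw [← integral_finsetSum _ fun j _ => hint i i j (Or.inl rfl)]
      congr 1
      funext y
      rw [← Finset.sum_mul, ← Finset.sum_mul, hsum, one_mul]
    rw [this]
    refine Finset.sum_congr rfl fun j _ => chartIntegral_eq μ hfd _ _ fun x hx => ⟨?_, ?_⟩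
    · refine hρ i (by_contra fun h => hx ?_)
      rw [dirDeriv_eq_zero_of_notMem_tsupport Z h, mul_zero]
    · exact hρ j (subset_tsupport _ (left_ne_zero_of_mul hx))
  have h2 : ∑ i : t, chartIntegral μ f (i : M) (dirDeriv Z (ρ i)) = 0 := by
    rw [Finset.sum_congr rfl fun i _ => h1 i, Finset.sum_comm]
    refine Finset.sum_eq_zero fun j _ => ?_
    simp only [chartIntegral]
    rw [← integral_finsetSum _ fun i _ => hint j i j (Or.inr rfl)]
    refine (integral_congr_ae (g := fun _ => 0)
      (Filter.Eventually.of_forall fun y => ?_)).trans (by simp)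
    simp only [← Finset.sum_mul, ← Finset.mul_sum]
    rw [sum_dirDeriv_eq_zero Z hsm hsum, mul_zero, zero_mul]
  -- The divergence theorem in each chart identifies the vanishing sum `h2` with `-c` times the
  -- total volume.
  have h3 : ∑ i : t, chartIntegral μ f (i : M) (ρ i) = 0 := by
    rw [Finset.sum_congr rfl fun (i : t) _ => chartIntegral_dirDeriv μ b (i : M) (hf i) (hZ i) (hdiv i)
      (hsm i) (hρ i), Finset.sum_neg_distrib, ← Finset.mul_sum, neg_eq_zero] at h2
    exact (mul_eq_zero.mp h2).resolve_left hc
  have hnn : ∀ i : t, 0 ≤ chartIntegral μ f i (ρ i) := fun i =>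
    integral_nonneg fun y => mul_nonneg (ρ.nonneg i _) (hpos _ _).le
  obtain ⟨p⟩ := ‹Nonempty M›
  obtain ⟨i, hi⟩ : ∃ i, ρ i p ≠ 0 := by
    by_contra! h
    simpa [h] using hsum p
  have hp : p ∈ (chartAt E (i : M)).source := hρ i (subset_tsupport _ hi)
  have hzero := (Finset.sum_eq_zero_iff_of_nonneg fun i _ => hnn i).mp h3 i (Finset.mem_univ i)
  have hI := integrableOn_chart μ (i : M) (isClosed_tsupport (ρ i)) (hρ i)
    (fun x hx => image_eq_zero_of_notMem_tsupport hx)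
    (contDiffOn_comp_chart_symm (hsm i) i).continuousOn (hf i).continuousOn
  rw [chartIntegral, setIntegral_eq_zero_iff_of_nonneg_ae (Filter.Eventually.of_forall fun y =>
    mul_nonneg (ρ.nonneg i _) (hpos _ _).le) hI] at hzero
  -- A continuous function vanishing almost everywhere on an open set vanishes on it, but this one
  -- is nonzero at the image of `p`.
  have hae := Measure.eqOn_open_of_ae_eq hzero (chartAt E (i : M)).open_target
    ((contDiffOn_comp_chart_symm (hsm i) i).continuousOn.mul (hf i).continuousOn)
    continuousOn_const
  have := hae ((chartAt E (i : M)).map_source hp)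
  simp only [Pi.zero_apply, (chartAt E (i : M)).left_inv hp] at this
  exact mul_ne_zero hi (hpos _ _).ne' this

end Integration

/-! ### Linear algebra of the bilinear form `a ⊗ a + c`. -/

section PointwiseAlgebra

variable {V : Type*} [AddCommGroup V] [Module ℝ V] {κ : Type*} [Fintype κ]

theorem sum_mul_apply_one (b : κ → V) (a : V [⋀^Fin 1]→ₗ[ℝ] ℝ) (t : κ → ℝ) :
    ∑ k, t k * a ![b k] = a ![∑ k, t k • b k] := by
  let L : V →ₗ[ℝ] ℝ := ⟨⟨fun v => a ![v], fun u v => a.map_vecCons_add ![] u v⟩,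
    fun c v => a.map_vecCons_smul ![] c v⟩
  change ∑ k, t k * L (b k) = L (∑ k, t k • b k)
  simp

theorem sum_mul_apply_two (b : κ → V) (c : V [⋀^Fin 2]→ₗ[ℝ] ℝ) (t : κ → ℝ) (v : V) :
    ∑ k, t k * c ![b k, v] = c ![∑ k, t k • b k, v] := by
  let L : V →ₗ[ℝ] ℝ := ⟨⟨fun u => c ![u, v], fun u u' => c.map_vecCons_add ![v] u u'⟩,
    fun r u => c.map_vecCons_smul ![v] r u⟩
  change ∑ k, t k * L (b k) = L (∑ k, t k • b k)
  simp

theorem apply_two_swap (c : V [⋀^Fin 2]→ₗ[ℝ] ℝ) (u v : V) : c ![u, v] = -c ![v, u] := by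
  rw [← c.map_swap ![v, u] (i := 0) (j := 1) (by simp)]
  congr 1
  ext i
  fin_cases i <;> simp

/-- The matrix of the bilinear form `a ⊗ a + c`. -/
def formMatrix (b : κ → V) (a : V [⋀^Fin 1]→ₗ[ℝ] ℝ) (c : V [⋀^Fin 2]→ₗ[ℝ] ℝ) : Matrix κ κ ℝ :=
  Matrix.of fun i j => a ![b i] * a ![b j] + c ![b i, b j]

theorem vecMul_formMatrix (b : κ → V) (a : V [⋀^Fin 1]→ₗ[ℝ] ℝ) (c : V [⋀^Fin 2]→ₗ[ℝ] ℝ)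
    (t : κ → ℝ) (j : κ) : Matrix.vecMul t (formMatrix b a c) j =
      a ![∑ k, t k • b k] * a ![b j] + c ![∑ k, t k • b k, b j] := by
  simp only [Matrix.vecMul, dotProduct, formMatrix, Matrix.of_apply, mul_add,
    Finset.sum_add_distrib, ← mul_assoc, ← Finset.sum_mul, sum_mul_apply_one, sum_mul_apply_two]

/-- Two vectors pair with a basis in the same way, hence with every vector. -/
theorem apply_eq_of_basis (b : Module.Basis κ ℝ V) {a a' : V [⋀^Fin 1]→ₗ[ℝ] ℝ}
    {c : V [⋀^Fin 2]→ₗ[ℝ] ℝ} {s : ℝ} {z : V}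
    (h : ∀ j, s * a ![b j] + c ![z, b j] = a' ![b j]) (v : V) :
    s * a ![v] + c ![z, v] = a' ![v] := by
  have h1 : ∑ k, b.repr v k * (s * a ![b k] + c ![z, b k]) = ∑ k, b.repr v k * a' ![b k] :=
    Finset.sum_congr rfl fun k _ => by rw [h]
  have h2 : ∑ k, b.repr v k * (s * a ![b k] + c ![z, b k]) =
      s * ∑ k, b.repr v k * a ![b k] - ∑ k, b.repr v k * c ![b k, z] := by
    rw [Finset.mul_sum, ← Finset.sum_sub_distrib]
    refine Finset.sum_congr rfl fun k _ => ?_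
    rw [apply_two_swap c z]
    ring
  rw [h2, sum_mul_apply_one, sum_mul_apply_one, sum_mul_apply_two, b.sum_repr,
    apply_two_swap c v, sub_neg_eq_add] at h1
  exact h1

variable [DecidableEq κ]

/-- A vector `z` in the left kernel satisfies `a(z) a + c(z, ·) = 0`. Evaluation at `r` gives `a(z)
= 0`, then `c(z, ·) = 0`, and `hnd` applies. -/
theorem det_formMatrix_ne_zero (b : Module.Basis κ ℝ V) {a : V [⋀^Fin 1]→ₗ[ℝ] ℝ}
    {c : V [⋀^Fin 2]→ₗ[ℝ] ℝ} {r : V} (hr : a ![r] = 1) (hcr : ∀ v, c ![r, v] = 0)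
    (hnd : ∀ w, a ![w] = 0 → (∀ v, c ![w, v] = 0) → w = 0) : (formMatrix b a c).det ≠ 0 := by
  intro hdet
  obtain ⟨t, ht, ht0⟩ := Matrix.exists_vecMul_eq_zero_iff.mpr hdet
  apply ht
  set z := ∑ k, t k • b k
  have h1 : ∀ v, a ![z] * a ![v] + c ![z, v] = 0 := fun v =>
    apply_eq_of_basis (a' := 0) b (fun j => by
      rw [← vecMul_formMatrix, ht0]
      rfl) v
  have h2 : a ![z] = 0 := by
    have := h1 r
    rwa [hr, apply_two_swap c z, hcr, neg_zero, add_zero, mul_one] at this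
  have hz : z = 0 := hnd z h2 fun v => by
    have := h1 v
    rwa [h2, zero_mul, zero_add] at this
  funext k
  exact (Fintype.linearIndependent_iff.mp b.linearIndependent) t hz k

/-- Nondegeneracy solves `a(z) a + c(z, ·) = a'`; evaluation at `r` gives `a(z) = a'(r) = 0`, so the
first term drops out. -/
theorem exists_contract_eq (b : Module.Basis κ ℝ V) {a a' : V [⋀^Fin 1]→ₗ[ℝ] ℝ}
    {c : V [⋀^Fin 2]→ₗ[ℝ] ℝ} {r : V} (hr : a ![r] = 1) (hcr : ∀ v, c ![r, v] = 0)
    (hr' : a' ![r] = 0) (hdet : (formMatrix b a c).det ≠ 0) :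
    ∃ z, a ![z] = 0 ∧ ∀ v, c ![z, v] = a' ![v] := by
  set t := Matrix.vecMul (fun j => a' ![b j]) (formMatrix b a c)⁻¹
  set z := ∑ k, t k • b k
  have h1 : ∀ v, a ![z] * a ![v] + c ![z, v] = a' ![v] := fun v =>
    apply_eq_of_basis b (fun j => by
      rw [← vecMul_formMatrix, Matrix.vecMul_vecMul,
        Matrix.nonsing_inv_mul _ (isUnit_iff_ne_zero.mpr hdet), Matrix.vecMul_one]) v
  have h2 : a ![z] = 0 := by
    have := h1 r
    rwa [hr, apply_two_swap c z, hcr, neg_zero, add_zero, mul_one, hr'] at this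
  refine ⟨z, h2, fun v => ?_⟩
  have := h1 v
  rwa [h2, zero_mul, zero_add] at this

/-- The solution is unique and depends rationally on the coefficients, which makes a field of
solutions chosen pointwise smooth. -/
theorem repr_eq_vecMul_inv (b : Module.Basis κ ℝ V) {a a' : V [⋀^Fin 1]→ₗ[ℝ] ℝ}
    {c : V [⋀^Fin 2]→ₗ[ℝ] ℝ} (hdet : (formMatrix b a c).det ≠ 0) {z : V} (hz : a ![z] = 0)
    (hcz : ∀ v, c ![z, v] = a' ![v]) :
    (b.repr z : κ → ℝ) = Matrix.vecMul (fun j => a' ![b j]) (formMatrix b a c)⁻¹ := by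
  have h : Matrix.vecMul (b.repr z) (formMatrix b a c) = fun j => a' ![b j] := by
    funext j
    rw [vecMul_formMatrix, b.sum_repr, hz, hcz, zero_mul, zero_add]
  rw [← h, Matrix.vecMul_vecMul, Matrix.mul_nonsing_inv _ (isUnit_iff_ne_zero.mpr hdet),
    Matrix.vecMul_one]

/-- The pulled back bilinear form has matrix `Tᵀ B T`. -/
theorem det_formMatrix_compLinearMap (b : Module.Basis κ ℝ V) (a : V [⋀^Fin 1]→ₗ[ℝ] ℝ)
    (c : V [⋀^Fin 2]→ₗ[ℝ] ℝ) (T : V →ₗ[ℝ] V) :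
    (formMatrix b (a.compLinearMap T) (c.compLinearMap T)).det =
      LinearMap.det T * (formMatrix b a c).det * LinearMap.det T := by
  have hT : ∀ i, ∑ k, LinearMap.toMatrix b b T k i • b k = T (b i) := fun i => by
    simp only [LinearMap.toMatrix_apply]
    exact b.sum_repr _
  have h1 : ∀ v : V, a.compLinearMap T ![v] = a ![T v] := fun v => by
    rw [AlternatingMap.compLinearMap_apply]
    congr 1
    funext i
    fin_cases i
    rfl
  have h2 : ∀ u v : V, c.compLinearMap T ![u, v] = c ![T u, T v] := fun u v => by
    rw [AlternatingMap.compLinearMap_apply]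
    congr 1
    funext i
    fin_cases i <;> rfl
  have h : formMatrix b (a.compLinearMap T) (c.compLinearMap T) =
      (LinearMap.toMatrix b b T).transpose * (formMatrix b a c * LinearMap.toMatrix b b T) := by
    ext i j
    simp only [Matrix.mul_apply, Matrix.transpose_apply]
    have e1 : ∀ k, ∑ l, formMatrix b a c k l * LinearMap.toMatrix b b T l j =
        a ![b k] * a ![T (b j)] + c ![b k, T (b j)] := fun k => by
      rw [← hT j, apply_two_swap c, ← sum_mul_apply_one, ← sum_mul_apply_two, Finset.mul_sum,
        ← sub_eq_add_neg, ← Finset.sum_sub_distrib]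
      refine Finset.sum_congr rfl fun l _ => ?_
      rw [apply_two_swap c (b l)]
      simp only [formMatrix, Matrix.of_apply]
      ring
    simp only [e1, mul_add, Finset.sum_add_distrib, ← mul_assoc, ← Finset.sum_mul,
      sum_mul_apply_one, sum_mul_apply_two, hT]
    simp only [formMatrix, Matrix.of_apply, h1, h2]
  rw [h, Matrix.det_mul, Matrix.det_mul, Matrix.det_transpose, LinearMap.det_toMatrix]
  ring

end PointwiseAlgebra

/-! ### The forms `η` and `dβ` in charts, and the contradiction on a closed manifold. -/

section ChartForms

variable {E : Type*} [NormedAddCommGroup E] [NormedSpace ℝ E]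
  {M : Type*} [TopologicalSpace M] [ChartedSpace E M]

theorem coordRep_apply_one (w : FormField E M 1) (x₀ : M) (y v : E) :
    coordRep w x₀ y ![v] = w ((chartAt E x₀).symm y)
      ![mfderiv 𝓘(ℝ, E) 𝓘(ℝ, E) (chartAt E x₀).symm y v] := by
  refine congrArg (w ((chartAt E x₀).symm y)) (funext fun i => ?_)
  fin_cases i
  rfl

theorem coordRep_apply_two (w : FormField E M 2) (x₀ : M) (y u v : E) :
    coordRep w x₀ y ![u, v] = w ((chartAt E x₀).symm y)
      ![mfderiv 𝓘(ℝ, E) 𝓘(ℝ, E) (chartAt E x₀).symm y u,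
        mfderiv 𝓘(ℝ, E) 𝓘(ℝ, E) (chartAt E x₀).symm y v] := by
  refine congrArg (w ((chartAt E x₀).symm y)) (funext fun i => ?_)
  fin_cases i <;> rfl

theorem extDeriv_apply_two {a : E → E [⋀^Fin 1]→L[ℝ] ℝ} {y : E} (ha : DifferentiableAt ℝ a y)
    (u v : E) : extDeriv a y ![u, v] =
      fderiv ℝ (fun z => a z ![v]) y u - fderiv ℝ (fun z => a z ![u]) y v := by
  rw [extDeriv_apply ha, Fin.sum_univ_two]
  have h0 : (0 : Fin 2).removeNth ![u, v] = ![v] := by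
    funext i; fin_cases i; rfl
  have h1 : (1 : Fin 2).removeNth ![u, v] = ![u] := by
    funext i; fin_cases i; rfl
  rw [h0, h1]
  simp [sub_eq_add_neg]

theorem extDeriv_apply_three {a : E → E [⋀^Fin 2]→L[ℝ] ℝ} {y : E} (ha : DifferentiableAt ℝ a y)
    (t u v : E) : extDeriv a y ![t, u, v] =
      fderiv ℝ (fun z => a z ![u, v]) y t - fderiv ℝ (fun z => a z ![t, v]) y u +
        fderiv ℝ (fun z => a z ![t, u]) y v := by
  rw [extDeriv_apply ha, Fin.sum_univ_three]
  have h0 : (0 : Fin 3).removeNth ![t, u, v] = ![u, v] := by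
    funext i; fin_cases i <;> rfl
  have h1 : (1 : Fin 3).removeNth ![t, u, v] = ![t, v] := by
    funext i; fin_cases i <;> rfl
  have h2 : (2 : Fin 3).removeNth ![t, u, v] = ![t, u] := by
    funext i; fin_cases i <;> rfl
  rw [h0, h1, h2]
  simp [sub_eq_add_neg]

theorem IsSmoothForm.contDiffOn_apply {k : ℕ} {w : FormField E M k} (hw : IsSmoothForm w) (x₀ : M)
    (v : Fin k → E) :
    ContDiffOn ℝ ∞ (fun y => coordRep w x₀ y v) (chartAt E x₀).target :=
  (ContinuousAlternatingMap.apply ℝ E ℝ v).contDiff.comp_contDiffOn (hw x₀)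

theorem contDiffOn_det {κ : Type*} [Fintype κ] [DecidableEq κ] {B : E → Matrix κ κ ℝ} {s : Set E}
    (h : ∀ i j, ContDiffOn ℝ ∞ (fun z => B z i j) s) : ContDiffOn ℝ ∞ (fun z => (B z).det) s := by
  simp only [Matrix.det_apply']
  exact ContDiffOn.sum fun σ _ => contDiffOn_const.mul (contDiffOn_prod fun i _ => h _ _)

theorem contDiffOn_inv_apply {κ : Type*} [Fintype κ] [DecidableEq κ] {B : E → Matrix κ κ ℝ}
    {s : Set E} (h : ∀ i j, ContDiffOn ℝ ∞ (fun z => B z i j) s) (h0 : ∀ z ∈ s, (B z).det ≠ 0)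
    (i j : κ) : ContDiffOn ℝ ∞ (fun z => (B z)⁻¹ i j) s := by
  simp only [Matrix.inv_def, Matrix.smul_apply, Ring.inverse_eq_inv', smul_eq_mul,
    Matrix.adjugate_apply]
  refine ((contDiffOn_det h).inv h0).mul (contDiffOn_det fun k l => ?_)
  by_cases hk : k = j
  · subst hk
    simp only [Matrix.updateRow_self]
    exact contDiffOn_const
  · simp only [Matrix.updateRow_ne hk]
    exact h k l

/-- The matrix of `η ⊗ η + ω` in the chart at `x₀`. -/
def chartMatrix {κ : Type*} (b : Module.Basis κ ℝ E) (η : FormField E M 1) (w : FormField E M 2) (x₀ : M) :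
    E → Matrix κ κ ℝ :=
  sqAddMatrix (fun i z => coordRep η x₀ z ![b i]) fun i j z => coordRep w x₀ z ![b i, b j]

theorem chartMatrix_eq_formMatrix {κ : Type*} (b : Module.Basis κ ℝ E) (η : FormField E M 1)
    (w : FormField E M 2) (x₀ : M) (y : E) : chartMatrix b η w x₀ y =
      formMatrix b (coordRep η x₀ y).toAlternatingMap (coordRep w x₀ y).toAlternatingMap := rfl

variable [IsManifold 𝓘(ℝ, E) ∞ M]

theorem mfderiv_symm_chartVec (Z : ∀ x : M, TangentSpace 𝓘(ℝ, E) x) (x₀ : M) {y : E}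
    (hy : y ∈ (chartAt E x₀).target) :
    mfderiv 𝓘(ℝ, E) 𝓘(ℝ, E) (chartAt E x₀).symm y (chartVec (E := E) Z x₀ y) =
      Z ((chartAt E x₀).symm y) := by
  have : IsManifold 𝓘(ℝ, E) 1 M := IsManifold.of_le (n := ∞) (by simp)
  have h := (mdifferentiable_chart (I := 𝓘(ℝ, E)) x₀).symm_comp_deriv
    ((chartAt E x₀).map_target hy)
  rw [(chartAt E x₀).right_inv hy] at h
  exact congrArg (fun L => L (Z ((chartAt E x₀).symm y))) h

theorem mfderiv_symm_eq_zero (x₀ : M) {y : E} (hy : y ∈ (chartAt E x₀).target) {v : E}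
    (hv : mfderiv 𝓘(ℝ, E) 𝓘(ℝ, E) (chartAt E x₀).symm y v = 0) : v = 0 := by
  have : IsManifold 𝓘(ℝ, E) 1 M := IsManifold.of_le (n := ∞) (by simp)
  have h := (mdifferentiable_chart (I := 𝓘(ℝ, E)) x₀).comp_symm_deriv hy
  have h1 := congrArg (fun L => L v) h
  have h2 : mfderiv 𝓘(ℝ, E) 𝓘(ℝ, E) (chartAt E x₀) ((chartAt E x₀).symm y)
      (mfderiv 𝓘(ℝ, E) 𝓘(ℝ, E) (chartAt E x₀).symm y v) = v := h1
  rw [← h2, hv]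
  exact map_zero _

theorem surjective_mfderiv_symm (x₀ : M) {y : E} (hy : y ∈ (chartAt E x₀).target) :
    Function.Surjective (mfderiv 𝓘(ℝ, E) 𝓘(ℝ, E) (chartAt E x₀).symm y) := fun v => by
  have : IsManifold 𝓘(ℝ, E) 1 M := IsManifold.of_le (n := ∞) (by simp)
  have h := (mdifferentiable_chart (I := 𝓘(ℝ, E)) x₀).symm_comp_deriv
    ((chartAt E x₀).map_target hy)
  rw [(chartAt E x₀).right_inv hy] at h
  exact ⟨_, congrArg (fun L => L v) h⟩

/-- The determinant is multiplied by the square of the Jacobian, so `|det|^(1/2)` is multiplied by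
its absolute value. -/
theorem isDensity_chartMatrix {κ : Type*} [Fintype κ] [DecidableEq κ]
    (b : Module.Basis κ ℝ E) {η : FormField E M 1} {w : FormField E M 2}
    (hdet : ∀ x₀, ∀ y ∈ (chartAt E x₀).target, (chartMatrix b η w x₀ y).det ≠ 0) :
    IsDensity fun x₀ => detDensity (chartMatrix b η w x₀) := by
  intro x₀ x₁ y hy hy'
  have h0 := hdet x₀ y hy
  have h1 : (chartMatrix b η w x₁ ((chartAt E x₁ ∘ (chartAt E x₀).symm) y)).det ≠ 0 :=
    hdet x₁ _ ((chartAt E x₁).map_source hy')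
  set T := fderiv ℝ (chartAt E x₁ ∘ (chartAt E x₀).symm) y
  have h : (chartMatrix b η w x₀ y).det = T.det *
      (chartMatrix b η w x₁ ((chartAt E x₁ ∘ (chartAt E x₀).symm) y)).det * T.det := by
    rw [chartMatrix_eq_formMatrix, chartMatrix_eq_formMatrix,
      coordRep_eq_pullback η x₀ x₁ hy hy', coordRep_eq_pullback w x₀ x₁ hy hy']
    exact det_formMatrix_compLinearMap b
      (coordRep η x₁ ((chartAt E x₁ ∘ (chartAt E x₀).symm) y)).toAlternatingMap
      (coordRep w x₁ ((chartAt E x₁ ∘ (chartAt E x₀).symm) y)).toAlternatingMap (T : E →ₗ[ℝ] E)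
  have hT : T.det ≠ 0 := fun h2 => h0 (by rw [h, h2, mul_zero])
  change Real.exp (Real.log _ / 2) = |T.det| * Real.exp (Real.log _ / 2)
  rw [h, Real.log_mul (mul_ne_zero hT h1) hT, Real.log_mul hT h1,
    show ∀ p q : ℝ, (p + q + p) / 2 = p + q / 2 from fun p q => by ring, Real.exp_add,
    Real.exp_log_eq_abs hT]

/-- On a closed manifold of dimension at least two there is no closed one-form `η` and one-form
`β` such that `η ⊗ η + dβ` is nondegenerate and some vector field `R` satisfies `η (R) = 1`,
`β (R) = 0` and `ι_R dβ = 0`. -/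
theorem not_exists_exact_transverse_symplectic [FiniteDimensional ℝ E] [T2Space M] [CompactSpace M]
    [Nonempty M] (hE : Module.finrank ℝ E ≠ 1) {η β : FormField E M 1} (hη : IsSmoothForm η)
    (hβ : IsSmoothForm β) (hdη : extDer η = 0) {R : ∀ x : M, TangentSpace 𝓘(ℝ, E) x}
    (hηR : ∀ x, η x ![R x] = 1) (hβR : ∀ x, β x ![R x] = 0)
    (hR : ∀ x v, extDer β x ![R x, v] = 0)
    (hnd : ∀ x w, η x ![w] = 0 → (∀ v, extDer β x ![w, v] = 0) → w = 0) : False := by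
  let b := Module.finBasis ℝ E
  let _ : MeasurableSpace E := borel E
  have : BorelSpace E := ⟨rfl⟩
  have hω := hβ.extDer
  have hdet : ∀ x₀, ∀ y ∈ (chartAt E x₀).target,
      (chartMatrix b η (extDer β) x₀ y).det ≠ 0 := by
    intro x₀ y hy
    rw [chartMatrix_eq_formMatrix]
    refine det_formMatrix_ne_zero b (r := chartVec R x₀ y) ?_ ?_ ?_
    · refine (coordRep_apply_one η x₀ y _).trans ?_
      rw [mfderiv_symm_chartVec R x₀ hy]
      exact hηR _
    · intro v
      refine (coordRep_apply_two _ x₀ y _ _).trans ?_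
      rw [mfderiv_symm_chartVec R x₀ hy]
      exact hR _ _
    · intro u hu hu'
      refine mfderiv_symm_eq_zero x₀ hy (hnd _ _ ((coordRep_apply_one η x₀ y _).symm.trans hu) ?_)
      intro v
      obtain ⟨v, rfl⟩ := surjective_mfderiv_symm x₀ hy v
      exact (coordRep_apply_two _ x₀ y _ _).symm.trans (hu' v)
  have hexists : ∀ x : M, ∃ z : TangentSpace 𝓘(ℝ, E) x, η x ![z] = 0 ∧
      ∀ v, extDer β x ![z, v] = β x ![v] := fun x =>
    exists_contract_eq (V := TangentSpace 𝓘(ℝ, E) x) b (a := (η x).toAlternatingMap)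
      (a' := (β x).toAlternatingMap) (c := (extDer β x).toAlternatingMap) (r := R x) (hηR x)
      (hR x) (hβR x) (det_formMatrix_ne_zero (V := TangentSpace 𝓘(ℝ, E) x) b (hηR x) (hR x)
        (hnd x))
  -- The choice is made point by point; smoothness follows in `hZk` from the explicit formula for
  -- the components.
  choose Z hZη hZβ using hexists
  have hZη' : ∀ x₀, ∀ y ∈ (chartAt E x₀).target, coordRep η x₀ y ![chartVec Z x₀ y] = 0 := by
    intro x₀ y hy
    rw [coordRep_apply_one, mfderiv_symm_chartVec Z x₀ hy]
    exact hZη _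
  have hZβ' : ∀ x₀, ∀ y ∈ (chartAt E x₀).target, ∀ v,
      coordRep (extDer β) x₀ y ![chartVec Z x₀ y, v] = coordRep β x₀ y ![v] := by
    intro x₀ y hy v
    rw [coordRep_apply_two, coordRep_apply_one, mfderiv_symm_chartVec Z x₀ hy]
    exact hZβ _ _
  have hentry : ∀ x₀ i j, ContDiffOn ℝ ∞ (fun z => chartMatrix b η (extDer β) x₀ z i j)
      (chartAt E x₀).target := fun x₀ i j =>
    ((hη.contDiffOn_apply x₀ _).mul (hη.contDiffOn_apply x₀ _)).add (hω.contDiffOn_apply x₀ _)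
  have hZk : ∀ x₀ k, ContDiffOn ℝ ∞ (fun y => b.repr (chartVec Z x₀ y) k)
      (chartAt E x₀).target := by
    intro x₀ k
    have h : ContDiffOn ℝ ∞ (fun y => ∑ j, coordRep β x₀ y ![b j] *
        (chartMatrix b η (extDer β) x₀ y)⁻¹ j k) (chartAt E x₀).target :=
      ContDiffOn.sum fun j _ => (hβ.contDiffOn_apply x₀ _).mul
        (contDiffOn_inv_apply (hentry x₀) (hdet x₀) j k)
    refine h.congr fun y hy => ?_
    exact congrFun (repr_eq_vecMul_inv b (a := (coordRep η x₀ y).toAlternatingMap)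
      (a' := (coordRep β x₀ y).toAlternatingMap) (c := (coordRep (extDer β) x₀ y).toAlternatingMap)
      (hdet x₀ y hy) (hZη' x₀ y hy) (hZβ' x₀ y hy)) k
  have hZs : ∀ x₀, ContDiffOn ℝ ∞ (chartVec Z x₀) (chartAt E x₀).target := by
    intro x₀
    have h : ContDiffOn ℝ ∞ (fun y => ∑ k, b.repr (chartVec Z x₀ y) k • b k)
        (chartAt E x₀).target := ContDiffOn.sum fun k _ => (hZk x₀ k).smul contDiffOn_const
    exact h.congr fun y _ => (b.sum_repr _).symm
  -- The expansion rate `(m - 1) / 2`; only here does the dimension matter.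
  have hcard : (Fintype.card (Fin (Module.finrank ℝ E)) - 1 : ℝ) / 2 ≠ 0 := by
    rw [Fintype.card_fin]
    refine div_ne_zero (sub_ne_zero.mpr ?_) two_ne_zero
    exact_mod_cast hE
  refine not_constant_divergence b (f := fun x₀ => detDensity (chartMatrix b η (extDer β) x₀))
    (Z := Z) hcard (isDensity_chartMatrix b hdet) (fun _ _ => Real.exp_pos _)
    (fun x₀ => (((contDiffOn_det (hentry x₀)).log (hdet x₀)).div_const 2).exp) hZs ?_
  intro x₀ y hy
  have hn := (chartAt E x₀).open_target.mem_nhds hy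
  have hdiff : ∀ {F : E → ℝ}, ContDiffOn ℝ ∞ F (chartAt E x₀).target → DifferentiableAt ℝ F y :=
    fun h => (h.contDiffAt hn).differentiableAt (by simp)
  refine divergence_detDensity (β := fun i z => coordRep β x₀ z ![b i])
    (h := fun i z => coordRep η x₀ z ![b i]) (Z := fun k z => b.repr (chartVec Z x₀ z) k)
    (W := fun i j z => coordRep (extDer β) x₀ z ![b i, b j]) (e := b)
    (r := b.repr (chartVec R x₀ y)) (fun i => hdiff (hη.contDiffOn_apply x₀ _))
    (fun k => hdiff (hZk x₀ k)) (fun i j => hdiff (hω.contDiffOn_apply x₀ _)) ?_ ?_ ?_ ?_ ?_ ?_ ?_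
    ?_ (hdet x₀ y hy)
  · intro i j
    have h := extDeriv_apply_two (hη.differentiableAt hy) (b i) (b j)
    rw [← coordRep_extDer hη x₀ hy, hdη] at h
    exact sub_eq_zero.mp h.symm
  · intro i j
    rw [coordRep_extDer hβ x₀ hy]
    exact extDeriv_apply_two (hβ.differentiableAt hy) (b i) (b j)
  · intro i j z
    exact apply_two_swap (coordRep (extDer β) x₀ z).toAlternatingMap (b i) (b j)
  · intro i j k
    have h := extDeriv_apply_three (hω.differentiableAt hy) (b k) (b i) (b j)
    rw [← coordRep_extDer hω x₀ hy, extDer_extDer hβ] at h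
    -- Swapping the two arguments turns the alternating sum for `d(dβ)` into the cyclic one.
    have h1 : (fun z => coordRep (extDer β) x₀ z ![b k, b j]) =
        fun z => -coordRep (extDer β) x₀ z ![b j, b k] := funext fun z =>
      apply_two_swap (coordRep (extDer β) x₀ z).toAlternatingMap (b k) (b j)
    rw [h1, fderiv_fun_neg, neg_apply, sub_neg_eq_add] at h
    rw [← h]
    rfl
  · intro j
    filter_upwards [hn] with z hz
    refine (sum_mul_apply_two b (coordRep (extDer β) x₀ z).toAlternatingMap _ _).trans ?_
    rw [b.sum_repr]
    exact hZβ' x₀ z hz _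
  · filter_upwards [hn] with z hz
    refine (sum_mul_apply_one b (coordRep η x₀ z).toAlternatingMap _).trans ?_
    rw [b.sum_repr]
    exact hZη' x₀ z hz
  · simp only [mul_comm (coordRep η x₀ y _)]
    refine (sum_mul_apply_one b (coordRep η x₀ y).toAlternatingMap _).trans ?_
    rw [b.sum_repr]
    refine (coordRep_apply_one η x₀ y _).trans ?_
    rw [mfderiv_symm_chartVec R x₀ hy]
    exact hηR _
  · intro i
    have h : ∑ j, b.repr (chartVec R x₀ y) j * coordRep (extDer β) x₀ y ![b j, b i] = 0 := by
      refine (sum_mul_apply_two b (coordRep (extDer β) x₀ y).toAlternatingMap _ _).trans ?_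
      rw [b.sum_repr]
      refine (coordRep_apply_two _ x₀ y _ _).trans ?_
      rw [mfderiv_symm_chartVec R x₀ hy]
      exact hR _ _
    rw [← neg_eq_zero, ← h, ← Finset.sum_neg_distrib]
    refine Finset.sum_congr rfl fun j _ => ?_
    have := apply_two_swap (coordRep (extDer β) x₀ y).toAlternatingMap (b i) (b j)
    change coordRep (extDer β) x₀ y ![b i, b j] = -coordRep (extDer β) x₀ y ![b j, b i] at this
    rw [this]
    ring

end ChartForms

end BasicCoh

end

/-! ### Contact forms: reduction to a closed `η = λ - β`. -/

theorem theorem2p1 (n : ℕ) (hn : 1 ≤ n)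
    (M : Type*) [TopologicalSpace M] [ChartedSpace (EuclideanSpace ℝ (Fin (2 * n + 1))) M]
    [IsManifold (𝓡 (2 * n + 1)) ∞ M] [T2Space M] [CompactSpace M] [Nonempty M]
    (lam : BasicCoh.FormField (EuclideanSpace ℝ (Fin (2 * n + 1))) M 1)
    (hlam : BasicCoh.IsContactForm n lam)
    (R : ∀ x : M, TangentSpace (𝓡 (2 * n + 1)) x) (hR : BasicCoh.IsReebField lam R) :
    BasicCoh.basicClass (BasicCoh.lineFoliation R) 2 (BasicCoh.dReeb hlam.1 hR) ≠ 0 := by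
  intro hzero
  have hmem := (Submodule.Quotient.mk_eq_zero _).mp hzero
  obtain ⟨⟨β, hβs, hβb⟩, hβ⟩ : ∃ β, BasicCoh.basicD (BasicCoh.lineFoliation R) 1 β =
      (BasicCoh.dReeb hlam.1 hR).1 := hmem
  have hdβ : BasicCoh.extDer β = BasicCoh.extDer lam := congrArg Subtype.val hβ
  have hfun : ∀ {V : Type} (v : V), (fun _ : Fin 1 => v) = ![v] := fun v => by
    funext i
    fin_cases i
    rfl
  have hlamR : ∀ x, lam x ![R x] = 1 := fun x => by
    rw [← hfun]
    exact (hR x).1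
  -- The contraction of a one-form is a form of degree zero, read off on the empty tuple. This is
  -- where `β` being basic is used.
  have hβR : ∀ x, β x ![R x] = 0 := fun x =>
    congrArg (fun c => c ![]) (hβb x (R x) (Submodule.mem_span_singleton_self _)).1
  have hdR : ∀ x v, BasicCoh.extDer β x ![R x, v] = 0 := fun x v => by
    rw [hdβ]
    exact congrArg (fun c => c ![v]) (hR x).2
  have hneg : BasicCoh.IsSmoothForm ((-1 : ℝ) • β) := fun x₀ => by
    rw [BasicCoh.coordRep_smul]
    exact (hβs x₀).const_smul (-1 : ℝ)
  refine BasicCoh.not_exists_exact_transverse_symplectic (η := lam + (-1 : ℝ) • β) (β := β)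
    (R := R) (by simp; omega) (fun x₀ => (hlam.1 x₀).add (hneg x₀)) hβs ?_ ?_ hβR hdR ?_
  · rw [BasicCoh.extDer_add hlam.1 hneg, BasicCoh.extDer_smul, hdβ]
    exact (congrArg _ (neg_one_smul ℝ _)).trans (add_neg_cancel _)
  · intro x
    change lam x ![R x] + (-1 : ℝ) * β x ![R x] = 1
    rw [hlamR, hβR, mul_zero, add_zero]
  · intro x w hw hw'
    set c := lam x ![w]
    -- Removing the Reeb component gives `λ(u) = 0` and `ι_u dλ = 0`, so `u = 0` by the contact
    -- condition and `w = c R`. Then `β(w) = 0`, and `η(w) = 0` forces `c = λ(w) = 0`.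
    set u : TangentSpace (𝓡 (2 * n + 1)) x := w + (-c) • R x
    have hlin : ∀ a : BasicCoh.FormField (EuclideanSpace ℝ (Fin (2 * n + 1))) M 1,
        a x ![u] = a x ![w] + -c * a x ![R x] := fun a =>
      ((a x).toAlternatingMap.map_vecCons_add ![] w _).trans
        (congrArg _ ((a x).toAlternatingMap.map_vecCons_smul ![] (-c) (R x)))
    have hfd : FiniteDimensional ℝ (TangentSpace (𝓡 (2 * n + 1)) x) :=
      inferInstanceAs (FiniteDimensional ℝ (EuclideanSpace ℝ (Fin (2 * n + 1))))
    have hu : u = 0 := by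
      refine BasicCoh.eq_zero_of_wedge_ne_zero (V := TangentSpace (𝓡 (2 * n + 1)) x)
        (n := n) ?_ (lam x).toAlternatingMap (BasicCoh.extDer lam x).toAlternatingMap (hlam.2 x)
        ?_ ?_
      · exact (finrank_euclideanSpace_fin (𝕜 := ℝ)).trans (add_comm _ _)
      · ext v
        rw [Subsingleton.elim v ![]]
        change lam x ![u] = 0
        rw [hlin, hlamR]
        ring
      · ext v
        have hv : v = ![v 0] := by
          rw [← hfun]
          funext i
          rw [Subsingleton.elim i 0]
        rw [hv]
        change BasicCoh.extDer lam x ![u, v 0] = 0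
        rw [← hdβ]
        refine ((BasicCoh.extDer β x).toAlternatingMap.map_vecCons_add ![v 0] w _).trans ?_
        rw [AlternatingMap.map_vecCons_smul]
        change BasicCoh.extDer β x ![w, v 0] + -c * BasicCoh.extDer β x ![R x, v 0] = 0
        rw [hw', hdR, mul_zero, add_zero]
    have hwR : w = c • R x := by
      have : w = u + c • R x := by
        simp [u]
      rw [this, hu, zero_add]
    have hβw : β x ![u] = β x ![w] := by rw [hlin, hβR, mul_zero, add_zero]
    have hβw0 : β x ![w] = 0 := by
      rw [← hβw, hu]
      exact (β x).toAlternatingMap.map_coord_zero 0 rfl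
    have hc : c = 0 := by
      change lam x ![w] + (-1 : ℝ) * β x ![w] = 0 at hw
      rw [hβw0, mul_zero, add_zero] at hw
      exact hw
    rw [hwR, hc, zero_smul]
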